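/- Theorem (positivity of the Lyapunov exponent for the Anderson model). Let $\nu$ be a Borel probability measure on $\mathbb{R}$ whose topological support $\operatorname{supp}\nu$ is compact and contains at least two points. Let $\Omega = (\operatorname{supp}\nu)^{\mathbb{Z}}$ carry the product measure $\mu = \nu^{\mathbb{Z}}$, and consider the discrete one-dimensional Anderson model $$[H_\omega\psi](n) = \psi(n+1)+\psi(n-1)+V_\omega(n)\psi(n), \qquad V_\omega(n)=\omega_n,\quad \omega\in\Omega .$$ For $E\in\mathbb{R}$ and $n\ge 1$ let $$M_{E,\omega}(n) = \begin{pmatrix} E-V_\omega(n) & -1\\ 1 & 0\end{pmatrix}\times\cdots\times\begin{pmatrix} E-V_\omega(1) & -1\\ 1 & 0\end{pmatrix}$$ be the transfer matrices, let $\|\cdot\|$ be the operator norm induced by the Euclidean norm on $\mathbb{R}^2$, and set $$\gamma(E) = \inf_{n\ge1}\frac1n\int_\Omega \log\|M_{E,\omega}(n)\|\,d\mu(\omega).$$ Then for every $E\in\mathbb{R}$ the number $\gamma(E)$ is the Lyapunov exponent at energy $E$, that is, $\lim_{n\to\infty}\frac1n\log\|M_{E,\omega}(n)\| = \gamma(E)$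 for $\mu$-almost every $\omega\in\Omega$, and $\gamma(E)>0$. -/

import Mathlib

open MeasureTheory Filter Topology

noncomputable section

namespace Anderson

/-- The phase space `Ω = (supp ν)^ℤ` of the discrete Anderson model with single-site
distribution `ν`. -/
abbrev PhaseSpace (ν : Measure ℝ) : Type := ℤ → ν.support

/-- The single-site distribution `ν`, regarded as a measure on its topological support. -/
def singleSite (ν : Measure ℝ) : Measure ν.support := ν.comap Subtype.val

instance (ν : Measure ℝ) [IsProbabilityMeasure ν] : IsProbabilityMeasure (singleSite ν) := by
  constructor
  rw [singleSite, comap_subtype_coe_apply ν.isClosed_support.measurableSet, Set.image_univ,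
    Subtype.range_coe, prob_compl_eq_zero_iff ν.isClosed_support.measurableSet |>.1]
  exact ν.measure_compl_support

/-- The product measure `μ = ν^ℤ` on `Ω = (supp ν)^ℤ`: the coordinates `ω n` are independent,
each with distribution `ν`. -/
def law (ν : Measure ℝ) [IsProbabilityMeasure ν] : Measure (PhaseSpace ν) :=
  Measure.infinitePi fun _ : ℤ => singleSite ν

/-- The potential `V_ω(n) = ω_n`. -/
def potential {ν : Measure ℝ} (ω : PhaseSpace ν) (n : ℤ) : ℝ := (ω n : ℝ)

/-- The one-step matrix taking `(u(n), u(n-1))` to `(u(n+1), u(n))` for solutions `u` of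
`u(n+1) + u(n-1) + v u(n) = E u(n)`, where `v` is the value of the potential at the site `n`. -/
def stepMatrix (E v : ℝ) : Matrix (Fin 2) (Fin 2) ℝ := !![E - v, -1; 1, 0]

/-- The transfer matrix `M_{E,ω}(n) = A(ω_n) ⋯ A(ω_1)` from `(u(1), u(0))` to
`(u(n+1), u(n))`, `n ≥ 0`, where `A(v) = stepMatrix E v`. -/
def transferMatrix {ν : Measure ℝ} (E : ℝ) (ω : PhaseSpace ν) : ℕ → Matrix (Fin 2) (Fin 2) ℝ
  | 0 => 1
  | n + 1 => stepMatrix E (potential ω ((n : ℤ) + 1)) * transferMatrix E ω n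

/-- `log ‖M_{E,ω}(n)‖`, with the operator norm coming from the Euclidean norm on `ℝ²`. -/
def logNorm {ν : Measure ℝ} (E : ℝ) (n : ℕ) (ω : PhaseSpace ν) : ℝ :=
  Real.log ‖Matrix.toEuclideanCLM (n := Fin 2) (𝕜 := ℝ) (transferMatrix E ω n)‖

/-- `H_ω` has Lyapunov behavior at energy `E` with exponent `γ_ω(E) = γ`:
`lim (1/n) log ‖M_{E,ω}(n)‖ = γ` as `n → ∞`. -/
def HasLyapunovBehavior {ν : Measure ℝ} (E : ℝ) (ω : PhaseSpace ν) (γ : ℝ) : Prop :=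
  Tendsto (fun n : ℕ => (1 / (n : ℝ)) * logNorm E n ω) atTop (𝓝 γ)

/-- The Lyapunov exponent `γ(E) = inf_{n ≥ 1} (1/n) ∫ log ‖M_{E,ω}(n)‖ dμ(ω)`. -/
def lyapunovExponent (ν : Measure ℝ) [IsProbabilityMeasure ν] (E : ℝ) : ℝ :=
  ⨅ n : Set.Ici (1 : ℕ), (1 / ((n : ℕ) : ℝ)) * ∫ ω, logNorm E (n : ℕ) ω ∂(law ν)

end Anderson

end

/-! Convergence. `logNorm` is a subadditive cocycle over the shift, bounded because the step
matrices and their inverses are bounded for potential values in the compact support. For each `k`,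
the cocycle over consecutive blocks of length `k` is an i.i.d. sequence, so the strong law bounds
the upper growth rate by `(1/k) ∫ logNorm E k`, hence by `γ`. A Katznelson–Weiss covering of orbit
segments shows that the lower rate has integral at least `γ`
(`BoundedCocycle.le_integral_lowerRate`). Both rates are therefore `γ` almost surely
(`BoundedCocycle.tendsto_div`).

Positivity. The function `w ↦ 𝔼 ‖M(n) w‖⁻¹` is homogeneous of degree `-1`, so it is determined
almost everywhere by its values at `(x, 1)`, the `profile`. One more random matrix acts on the
profile as an average of translates by the law of `E - v`, followed by the inversion `x ↦ -1/x`,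
which is unitary on `L²(ℝ)` with weight `|x|⁻¹`. Averaging over nondegenerate translations loses
`L²` mass unless the mass lies far out; the inversion brings far mass back near `0`, where the next
averaging loses it. Two steps thus contract `L²` uniformly
(`TranslationAverage.exists_contraction`). So `𝔼 ‖M(n)‖⁻¹` decays exponentially, and Jensen makes `𝔼
log ‖M(n)‖` grow linearly. -/

/-! ### Subadditive cocycles and their lower growth rate -/

/-- A bounded nonnegative subadditive cocycle over the measure-preserving map `T`, whose values
change by a bounded amount when the base point is moved along an orbit. -/
structure BoundedCocycle {Ω : Type*} [MeasurableSpace Ω] (μ : Measure Ω) (T : Ω → Ω) (c : ℝ)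
    (g : ℕ → Ω → ℝ) : Prop where
  measurePreserving : MeasurePreserving T μ μ
  measurable : ∀ n, Measurable (g n)
  nonneg : ∀ n ω, 0 ≤ g n ω
  le_mul : ∀ n ω, g n ω ≤ n * c
  add_le : ∀ m n ω, g (m + n) ω ≤ g m ω + g n (T^[m] ω)
  shift_le : ∀ n ω, g n (T ω) ≤ g (n + 1) ω + c

namespace BoundedCocycle

variable {Ω : Type*} [MeasurableSpace Ω] {μ : Measure Ω} {T : Ω → Ω} {c : ℝ} {g : ℕ → Ω → ℝ}

/-- The lower exponential growth rate of a cocycle. -/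
noncomputable def lowerRate (g : ℕ → Ω → ℝ) (ω : Ω) : ℝ := liminf (fun n => g n ω / n) atTop

/-- The points from which the cocycle has not come down to its lower rate, up to `ε`, by
time `L`. -/
def slow (g : ℕ → Ω → ℝ) (ε : ℝ) (L : ℕ) : Set Ω :=
  {ω | ∀ n, 1 ≤ n → n ≤ L → n * (lowerRate g ω + ε) < g n ω}

theorem c_nonneg (h : BoundedCocycle μ T c g) (ω : Ω) : 0 ≤ c := by
  simpa using (h.nonneg 1 ω).trans (h.le_mul 1 ω)

theorem div_mem (h : BoundedCocycle μ T c g) (n : ℕ) (ω : Ω) :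
    0 ≤ g n ω / n ∧ g n ω / n ≤ c := by
  refine ⟨div_nonneg (h.nonneg n ω) n.cast_nonneg, ?_⟩
  exact div_le_of_le_mul₀ n.cast_nonneg (h.c_nonneg ω) (by linarith [h.le_mul n ω])

theorem isBoundedUnder_ge (h : BoundedCocycle μ T c g) (ω : Ω) :
    IsBoundedUnder (· ≥ ·) atTop fun n => g n ω / n :=
  isBoundedUnder_of ⟨0, fun n => (h.div_mem n ω).1⟩

theorem isBoundedUnder_le (h : BoundedCocycle μ T c g) (ω : Ω) :
    IsBoundedUnder (· ≤ ·) atTop fun n => g n ω / n :=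
  isBoundedUnder_of ⟨c, fun n => (h.div_mem n ω).2⟩

theorem measurable_lowerRate (h : BoundedCocycle μ T c g) : Measurable (lowerRate g) :=
  Measurable.liminf fun n => (h.measurable n).div_const _

theorem lowerRate_nonneg (h : BoundedCocycle μ T c g) (ω : Ω) : 0 ≤ lowerRate g ω :=
  le_liminf_of_le (h.isBoundedUnder_le ω).isCoboundedUnder_ge
    (Eventually.of_forall fun n => (h.div_mem n ω).1)

theorem frequently_lt (h : BoundedCocycle μ T c g) (ω : Ω) {a : ℝ} (ha : lowerRate g ω < a) :
    ∃ᶠ n in atTop, g n ω / n < a :=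
  frequently_lt_of_liminf_lt (h.isBoundedUnder_le ω).isCoboundedUnder_ge ha

theorem lowerRate_le_of_eventually (h : BoundedCocycle μ T c g) (ω : Ω) {a : ℝ}
    (ha : ∀ᶠ n in atTop, g n ω / n ≤ a) : lowerRate g ω ≤ a :=
  liminf_le_of_frequently_le ha.frequently (h.isBoundedUnder_ge ω)

theorem lowerRate_le (h : BoundedCocycle μ T c g) (ω : Ω) : lowerRate g ω ≤ c :=
  h.lowerRate_le_of_eventually ω (Eventually.of_forall fun n => (h.div_mem n ω).2)

/-- By `shift_le`, moving the base point costs at most `c`, which vanishes after division by the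
time. Only this direction is needed: in the covering, the rate at a later orbit point may be
replaced by the rate at the starting point. -/
theorem lowerRate_comp_le (h : BoundedCocycle μ T c g) (ω : Ω) :
    lowerRate g (T ω) ≤ lowerRate g ω := by
  refine le_of_forall_pos_le_add fun ε hε => ?_
  refine liminf_le_of_frequently_le ?_ (h.isBoundedUnder_ge _)
  have h1 := h.frequently_lt ω (a := lowerRate g ω + ε / 2) (by linarith)
  have h2 : Tendsto (fun n : ℕ => (lowerRate g ω + ε / 2 + c) / n) atTop (𝓝 0) :=
    tendsto_const_div_atTop_nhds_zero_nat _
  rw [frequently_atTop] at h1 ⊢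
  obtain ⟨N, hN⟩ := eventually_atTop.1 (h2.eventually (gt_mem_nhds (half_pos hε)))
  intro M
  obtain ⟨n, hn, hlt⟩ := h1 (max (max M N + 1) 2)
  have hn2 : 2 ≤ n := (le_max_right _ _).trans hn
  have hnM : max M N + 1 ≤ n := (le_max_left _ _).trans hn
  obtain ⟨m, rfl⟩ : ∃ m, n = m + 1 := ⟨n - 1, by omega⟩
  have hM : M ≤ m := by have := le_max_left M N; omega
  have hN' : N ≤ m := by have := le_max_right M N; omega
  have hm : (0 : ℝ) < m := by exact_mod_cast (by omega : 0 < m)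
  refine ⟨m, hM, ?_⟩
  have h3 := hN m hN'
  rw [div_lt_iff₀ hm] at h3
  rw [div_lt_iff₀ (by positivity)] at hlt
  push_cast at hlt
  rw [div_le_iff₀ hm]
  nlinarith [h.shift_le m ω]

theorem measurableSet_slow (h : BoundedCocycle μ T c g) (ε : ℝ) (L : ℕ) :
    MeasurableSet (slow g ε L) := by
  have h1 := h.measurable_lowerRate
  have h2 := h.measurable
  simp only [slow, Set.ofPred_forall]
  refine MeasurableSet.iInter fun n => MeasurableSet.iInter fun _ => MeasurableSet.iInter fun _ => ?_
  exact measurableSet_lt (by fun_prop) (h2 n)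

/-- The slow sets decrease in `L`, and no point lies in all of them, since a liminf is approached at
some positive time. -/
theorem tendsto_measure_slow (h : BoundedCocycle μ T c g) [IsFiniteMeasure μ] {ε : ℝ}
    (hε : 0 < ε) : Tendsto (fun L => μ.real (slow g ε L)) atTop (𝓝 0) := by
  have hanti : Antitone (slow g ε) := fun L L' hL ω hω n h1 h2 => hω n h1 (h2.trans hL)
  have hempty : ⋂ L, slow g ε L = ∅ := by
    refine Set.eq_empty_of_forall_notMem fun ω hω => ?_
    obtain ⟨n, hn, hlt⟩ := frequently_atTop.1
      (h.frequently_lt ω (a := lowerRate g ω + ε) (by linarith)) 1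
    have := Set.mem_iInter.1 hω n n hn le_rfl
    rw [div_lt_iff₀ (by exact_mod_cast hn)] at hlt
    linarith
  have := tendsto_measure_iInter_atTop (μ := μ) (s := slow g ε)
    (fun L => (h.measurableSet_slow ε L).nullMeasurableSet) hanti ⟨0, measure_ne_top _ _⟩
  rw [hempty, measure_empty] at this
  exact (ENNReal.tendsto_toReal ENNReal.zero_ne_top).comp this

theorem lowerRate_iterate_le (h : BoundedCocycle μ T c g) (m : ℕ) (ω : Ω) :
    lowerRate g (T^[m] ω) ≤ lowerRate g ω := by
  induction m with
  | zero => simp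
  | succ m ih =>
    rw [Function.iterate_succ_apply']
    exact (h.lowerRate_comp_le _).trans ih

/-- Covering an orbit segment by blocks along which the cocycle is small. -/
theorem le_of_covering (h : BoundedCocycle μ T c g) {ε : ℝ} (hε : 0 ≤ ε) (L : ℕ) (n : ℕ) :
    ∀ ω, g n ω ≤ n * (lowerRate g ω + ε) +
      c * (∑ i ∈ Finset.range n, (slow g ε L).indicator 1 (T^[i] ω)) + c * L := by
  induction n using Nat.strong_induction_on with
  | _ n ih =>
    intro ω
    have hc := h.c_nonneg ω
    have hX := h.lowerRate_nonneg ω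
    have hind : ∀ ω', (0 : ℝ) ≤ (slow g ε L).indicator 1 ω' :=
      fun ω' => Set.indicator_nonneg (fun _ _ => zero_le_one) ω'
    -- A final stretch shorter than `L` is charged to the term `c * L`.
    rcases le_or_gt n L with hn | hn
    · have h1 : (n : ℝ) ≤ L := by exact_mod_cast hn
      have h2 : 0 ≤ ∑ i ∈ Finset.range n, (slow g ε L).indicator (1 : Ω → ℝ) (T^[i] ω) :=
        Finset.sum_nonneg fun i _ => hind _
      have h3 := h.le_mul n ω
      have : 0 ≤ n * (lowerRate g ω + ε) := by positivity
      nlinarith [mul_nonneg hc h2]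
    · have step : ∀ m, 1 ≤ m → m ≤ n → g n ω ≤ g m ω + ((n - m : ℝ) * (lowerRate g ω + ε) +
          c * (∑ i ∈ Finset.Ico m n, (slow g ε L).indicator 1 (T^[i] ω)) + c * L) := by
        intro m hm1 hmn
        obtain ⟨k, rfl⟩ := Nat.exists_eq_add_of_le hmn
        refine (h.add_le m k ω).trans (add_le_add_right ((ih k (by omega) _).trans ?_) _)
        have e : ∑ i ∈ Finset.Ico m (m + k), (slow g ε L).indicator (1 : Ω → ℝ) (T^[i] ω) =
            ∑ i ∈ Finset.range k, (slow g ε L).indicator 1 (T^[i] (T^[m] ω)) := by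
          rw [Finset.sum_Ico_eq_sum_range]
          refine Finset.sum_congr (by simp) fun i _ => ?_
          rw [add_comm m i, Function.iterate_add_apply]
        rw [e]
        rw [show ((m + k : ℕ) : ℝ) - m = k by push_cast; ring]
        gcongr
        exact h.lowerRate_iterate_le m ω
      -- From a slow point advance by one step and pay `c`, accounted for by the indicator; from any
      -- other point jump a block of length at most `L` along which the cocycle is small.
      by_cases hω : ω ∈ slow g ε L
      · have h1 := step 1 le_rfl (by omega)
        rw [Finset.range_eq_Ico, Finset.sum_eq_sum_Ico_succ_bot (by omega)]
        have h2 := h.le_mul 1 ω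
        simp only [Function.iterate_zero, id, Set.indicator_of_mem hω, Pi.one_apply]
        push_cast at h1 h2
        nlinarith
      · obtain ⟨m, hm1, hmL, hm⟩ : ∃ m, 1 ≤ m ∧ m ≤ L ∧ g m ω ≤ m * (lowerRate g ω + ε) := by
          simpa [slow] using hω
        have h1 := step m hm1 (by omega)
        have h2 : ∑ i ∈ Finset.Ico m n, (slow g ε L).indicator (1 : Ω → ℝ) (T^[i] ω) ≤
            ∑ i ∈ Finset.range n, (slow g ε L).indicator 1 (T^[i] ω) := by
          rw [Finset.range_eq_Ico]
          exact Finset.sum_le_sum_of_subset_of_nonneg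
            (Finset.Ico_subset_Ico_left (Nat.zero_le m)) fun i _ _ => hind _
        nlinarith [mul_le_mul_of_nonneg_left h2 hc]

theorem integrable (h : BoundedCocycle μ T c g) [IsFiniteMeasure μ] (n : ℕ) :
    Integrable (g n) μ :=
  Integrable.of_mem_Icc 0 (n * c) (h.measurable n).aemeasurable
    (Eventually.of_forall fun ω => ⟨h.nonneg n ω, h.le_mul n ω⟩)

theorem integrable_lowerRate (h : BoundedCocycle μ T c g) [IsFiniteMeasure μ] :
    Integrable (lowerRate g) μ :=
  Integrable.of_mem_Icc 0 c h.measurable_lowerRate.aemeasurable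
    (Eventually.of_forall fun ω => ⟨h.lowerRate_nonneg ω, h.lowerRate_le ω⟩)

theorem integral_le_of_covering (h : BoundedCocycle μ T c g) [IsProbabilityMeasure μ] {ε : ℝ}
    (hε : 0 ≤ ε) (L n : ℕ) :
    ∫ ω, g n ω ∂μ ≤ n * (∫ ω, lowerRate g ω ∂μ + ε) + c * (n * μ.real (slow g ε L)) + c * L := by
  have hs := h.measurableSet_slow ε L
  have hi : ∀ i, Integrable (fun ω => (slow g ε L).indicator (1 : Ω → ℝ) (T^[i] ω)) μ := fun i =>
    ((h.measurePreserving.iterate i).integrable_comp_of_integrable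
      ((integrable_const (1 : ℝ)).indicator hs))
  have hI := h.integrable_lowerRate
  have hsum : Integrable (fun ω => ∑ i ∈ Finset.range n,
      (slow g ε L).indicator (1 : Ω → ℝ) (T^[i] ω)) μ := integrable_finsetSum _ fun i _ => hi i
  have h1 : Integrable (fun ω => n * (lowerRate g ω + ε)) μ :=
    (hI.add (integrable_const ε)).const_mul _
  have h2 := hsum.const_mul c
  have hint : ∀ i, ∫ ω, (slow g ε L).indicator (1 : Ω → ℝ) (T^[i] ω) ∂μ = μ.real (slow g ε L) := by
    intro i
    rw [← integral_map (h.measurePreserving.iterate i).measurable.aemeasurable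
      (by fun_prop (disch := assumption)), (h.measurePreserving.iterate i).map_eq]
    exact integral_indicator_one hs
  calc ∫ ω, g n ω ∂μ ≤ ∫ ω, (n * (lowerRate g ω + ε) +
        c * (∑ i ∈ Finset.range n, (slow g ε L).indicator 1 (T^[i] ω)) + c * L) ∂μ :=
        integral_mono (h.integrable n) ((h1.add h2).add (integrable_const _))
          (h.le_of_covering hε L n)
    _ = _ := by
        have h12 := h1.add h2
        simp only [Pi.add_def] at h12
        rw [integral_add h12 (integrable_const _), integral_add h1 h2,
          integral_const_mul, integral_const_mul, integral_finsetSum _ fun i _ => hi i,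
          integral_add hI (integrable_const _)]
        simp [hint]

theorem le_integral_lowerRate (h : BoundedCocycle μ T c g) [IsProbabilityMeasure μ] {γ : ℝ}
    (hγ : ∀ n : ℕ, n * γ ≤ ∫ ω, g n ω ∂μ) : γ ≤ ∫ ω, lowerRate g ω ∂μ := by
  refine le_of_forall_pos_le_add fun ε hε => ?_
  -- Divide by `n` and let `n → ∞` with `L` fixed; `L → ∞` then removes the slow set.
  have key : ∀ L, γ ≤ ∫ ω, lowerRate g ω ∂μ + ε + c * μ.real (slow g ε L) := by
    intro L
    have h2 : Tendsto (fun n : ℕ => ∫ ω, lowerRate g ω ∂μ + ε + c * μ.real (slow g ε L) +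
        c * L / n) atTop (𝓝 (∫ ω, lowerRate g ω ∂μ + ε + c * μ.real (slow g ε L) + 0)) :=
      tendsto_const_nhds.add (tendsto_const_div_atTop_nhds_zero_nat _)
    rw [add_zero] at h2
    refine ge_of_tendsto h2 ((eventually_gt_atTop 0).mono fun n hn => ?_)
    have hn' : (0 : ℝ) < n := by exact_mod_cast hn
    have h3 := (hγ n).trans (h.integral_le_of_covering hε.le L n)
    have h4 : c * L / n * n = c * L := div_mul_cancel₀ _ hn'.ne'
    refine le_of_mul_le_mul_left (h3.trans (le_of_eq ?_)) hn'
    linear_combination -h4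
  have h1 := ((h.tendsto_measure_slow hε).const_mul c).const_add (∫ ω, lowerRate g ω ∂μ + ε)
  rw [mul_zero, add_zero] at h1
  exact ge_of_tendsto' h1 key

/-- If the averages of a bounded cocycle are asymptotically at most `γ` almost surely, and `γ`
is a lower bound for their means, then they converge to `γ` almost surely. -/
theorem tendsto_div (h : BoundedCocycle μ T c g) [IsProbabilityMeasure μ] {γ : ℝ}
    (hγ : ∀ n : ℕ, n * γ ≤ ∫ ω, g n ω ∂μ)
    (hub : ∀ a, γ < a → ∀ᵐ ω ∂μ, ∀ᶠ n in atTop, g n ω / n ≤ a) :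
    ∀ᵐ ω ∂μ, Tendsto (fun n => g n ω / n) atTop (𝓝 γ) := by
  have hub' : ∀ᵐ ω ∂μ, ∀ k : ℕ, ∀ᶠ n in atTop, g n ω / n ≤ γ + 1 / ((k : ℝ) + 1) :=
    ae_all_iff.2 fun k => hub _ (by linarith [Nat.one_div_pos_of_nat (α := ℝ) (n := k)])
  have hlim : ∀ ω, (∀ k : ℕ, ∀ᶠ n in atTop, g n ω / n ≤ γ + 1 / ((k : ℝ) + 1)) →
      limsup (fun n => g n ω / n) atTop ≤ γ := by
    intro ω hω
    refine ge_of_tendsto' (x := atTop) (f := fun k : ℕ => γ + 1 / ((k : ℝ) + 1)) ?_ fun k =>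
      limsup_le_of_le (h.isBoundedUnder_ge ω).isCoboundedUnder_le (hω k)
    simpa using (tendsto_one_div_add_atTop_nhds_zero_nat (𝕜 := ℝ)).const_add γ
  have hle : lowerRate g ≤ᵐ[μ] fun _ => γ := hub'.mono fun ω hω =>
    (liminf_le_limsup (h.isBoundedUnder_le ω) (h.isBoundedUnder_ge ω)).trans (hlim ω hω)
  -- The lower rate is at most `γ` almost surely and has integral at least `γ`, so it equals `γ`.
  have heq : lowerRate g =ᵐ[μ] fun _ => γ := by
    refine (integral_eq_iff_of_ae_le h.integrable_lowerRate (integrable_const _) hle).1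
      (le_antisymm (integral_mono_ae h.integrable_lowerRate (integrable_const _) hle) ?_)
    simpa using h.le_integral_lowerRate hγ
  filter_upwards [hub', heq] with ω hω hω'
  exact tendsto_of_le_liminf_of_limsup_le hω'.ge (hlim ω hω) (h.isBoundedUnder_le ω)
    (h.isBoundedUnder_ge ω)

end BoundedCocycle

/-! ### Averages of translates and their `L²` contraction -/

open scoped ENNReal

theorem ENNReal.tsub_sq_add_two_mul_le (a b : ℝ≥0∞) :
    (a - b) ^ 2 + 2 * (a * b) ≤ a ^ 2 + b ^ 2 := by
  rcases le_total a b with h | h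
  · rw [tsub_eq_zero_of_le h]
    obtain ⟨c, rfl⟩ := exists_add_of_le h
    calc (0 : ℝ≥0∞) ^ 2 + 2 * (a * (a + c)) = 2 * (a * (a + c)) := by simp
      _ ≤ 2 * (a * (a + c)) + c ^ 2 := le_self_add
      _ = a ^ 2 + (a + c) ^ 2 := by ring
  · rcases eq_or_ne b ∞ with rfl | hb
    · simp
    obtain ⟨c, rfl⟩ := exists_add_of_le h
    rw [ENNReal.add_sub_cancel_left hb]
    exact le_of_eq (by ring)

theorem ENNReal.add_sq_le_two_mul (a b : ℝ≥0∞) : (a + b) ^ 2 ≤ 2 * a ^ 2 + 2 * b ^ 2 := by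
  have h := le_add_self.trans (ENNReal.tsub_sq_add_two_mul_le a b)
  calc (a + b) ^ 2 = a ^ 2 + b ^ 2 + 2 * (a * b) := by ring
    _ ≤ a ^ 2 + b ^ 2 + (a ^ 2 + b ^ 2) := by gcongr
    _ = 2 * a ^ 2 + 2 * b ^ 2 := by ring

theorem ENNReal.sq_le_two_mul_sq_add_tsub_sq (a b : ℝ≥0∞) :
    a ^ 2 ≤ 2 * b ^ 2 + 2 * (a - b) ^ 2 :=
  (pow_le_pow_left' le_add_tsub 2).trans (ENNReal.add_sq_le_two_mul b (a - b))

namespace TranslationAverage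

/-- The average of the translates of `f` by `σ`-distributed shifts. -/
noncomputable def avg (σ : Measure ℝ) (f : ℝ → ℝ≥0∞) (y : ℝ) : ℝ≥0∞ := ∫⁻ s, f (y + s) ∂σ

/-- The one-sided `L²` modulus of continuity of `f` under translation by `t`. -/
noncomputable def modulus (f : ℝ → ℝ≥0∞) (t : ℝ) : ℝ≥0∞ := ∫⁻ x, (f x - f (x + t)) ^ 2

variable {σ : Measure ℝ} {f : ℝ → ℝ≥0∞}

theorem measurable_avg [SFinite σ] (hf : Measurable f) : Measurable (avg σ f) :=
  Measurable.lintegral_prod_right' (f := fun p : ℝ × ℝ => f (p.1 + p.2)) (by fun_prop)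

theorem measurable_modulus (hf : Measurable f) : Measurable (modulus f) :=
  Measurable.lintegral_prod_right' (f := fun p : ℝ × ℝ => (f p.2 - f (p.2 + p.1)) ^ 2)
    (by fun_prop)

/-- The variance as a mean squared difference of two independent copies. Truncated subtraction keeps
only part of the square, hence an inequality. -/
theorem avg_variance_le [IsProbabilityMeasure σ] (hf : Measurable f) (y : ℝ) :
    (∫⁻ p, (f (y + p.1) - f (y + p.2)) ^ 2 ∂(σ.prod σ)) + 2 * avg σ f y ^ 2 ≤
      2 * ∫⁻ s, f (y + s) ^ 2 ∂σ := by
  have h1 : ∫⁻ p, f (y + p.1) * f (y + p.2) ∂(σ.prod σ) = avg σ f y ^ 2 := by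
    rw [lintegral_prod_mul (f := fun s => f (y + s)) (g := fun s => f (y + s)) (by fun_prop)
      (by fun_prop), sq]
    rfl
  rw [← h1, ← lintegral_const_mul _ (by fun_prop), ← lintegral_add_left (by fun_prop)]
  refine (lintegral_mono fun p => ENNReal.tsub_sq_add_two_mul_le _ _).trans (le_of_eq ?_)
  rw [lintegral_add_left (by fun_prop), lintegral_prod _ (by fun_prop),
    lintegral_prod _ (by fun_prop)]
  simp [two_mul]

theorem avg_sq_le [IsProbabilityMeasure σ] (hf : Measurable f) (y : ℝ) :
    avg σ f y ^ 2 ≤ ∫⁻ s, f (y + s) ^ 2 ∂σ := by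
  have h := le_add_self.trans (avg_variance_le (σ := σ) hf y)
  exact (ENNReal.mul_le_mul_iff_right (by simp) (by simp)).1 h

/-- Integrating the variance bound over `y`, where translation invariance leaves only the difference
of the two shifts: the `L²` mass lost in averaging controls the mean modulus. -/
theorem lintegral_modulus_add_le [IsProbabilityMeasure σ] (hf : Measurable f) :
    (∫⁻ p, modulus f (p.2 - p.1) ∂(σ.prod σ)) + 2 * ∫⁻ y, avg σ f y ^ 2 ≤ 2 * ∫⁻ x, f x ^ 2 := by
  have h1 : ∫⁻ p, modulus f (p.2 - p.1) ∂(σ.prod σ) =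
      ∫⁻ y, ∫⁻ p, (f (y + p.1) - f (y + p.2)) ^ 2 ∂(σ.prod σ) := by
    rw [lintegral_lintegral_swap (by fun_prop)]
    refine lintegral_congr fun p => ?_
    rw [← lintegral_add_right_eq_self _ (-p.1), modulus]
    rw [← lintegral_add_right_eq_self (fun x => (f x - f (x + (p.2 - p.1))) ^ 2) 0]
    refine lintegral_congr fun x => ?_
    congr 3 <;> ring
  have h2 : ∫⁻ y, ∫⁻ s, f (y + s) ^ 2 ∂σ = ∫⁻ x, f x ^ 2 := by
    rw [lintegral_lintegral_swap (by fun_prop)]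
    simp [lintegral_add_right_eq_self (fun x => f x ^ 2)]
  have hm := measurable_avg (σ := σ) hf
  have hm2 : Measurable fun y => ∫⁻ p, (f (y + p.1) - f (y + p.2)) ^ 2 ∂(σ.prod σ) :=
    Measurable.lintegral_prod_right'
      (f := fun q : ℝ × (ℝ × ℝ) => (f (q.1 + q.2.1) - f (q.1 + q.2.2)) ^ 2) (by fun_prop)
  rw [h1, ← h2, ← lintegral_const_mul _ (by fun_prop), ← lintegral_add_left hm2,
    ← lintegral_const_mul' _ _ (by simp)]
  exact lintegral_mono fun y => avg_variance_le hf y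

theorem lintegral_avg_sq_le [IsProbabilityMeasure σ] (hf : Measurable f) :
    ∫⁻ y, avg σ f y ^ 2 ≤ ∫⁻ x, f x ^ 2 := by
  have h := le_add_self.trans (lintegral_modulus_add_le (σ := σ) hf)
  exact (ENNReal.mul_le_mul_iff_right (by simp) (by simp)).1 h

theorem modulus_two_mul_le (hf : Measurable f) (t : ℝ) :
    modulus f (2 * t) ≤ 4 * modulus f t := by
  have h1 : modulus f t = ∫⁻ x, (f (x + t) - f (x + t + t)) ^ 2 := by
    rw [modulus, ← lintegral_add_right_eq_self _ t]
  calc modulus f (2 * t)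
      ≤ ∫⁻ x, (2 * (f x - f (x + t)) ^ 2 + 2 * (f (x + t) - f (x + t + t)) ^ 2) := by
        refine lintegral_mono fun x => ?_
        refine le_trans (pow_le_pow_left' ?_ 2) (ENNReal.add_sq_le_two_mul _ _)
        rw [show x + 2 * t = x + t + t by ring]
        exact tsub_le_tsub_add_tsub
    _ = 2 * modulus f t + 2 * modulus f t := by
        rw [lintegral_add_left (by fun_prop), lintegral_const_mul _ (by fun_prop),
          lintegral_const_mul _ (by fun_prop), ← h1, modulus]
    _ = 4 * modulus f t := by ring

theorem modulus_two_pow_mul_le (hf : Measurable f) (t : ℝ) (k : ℕ) :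
    modulus f (2 ^ k * t) ≤ 4 ^ k * modulus f t := by
  induction k with
  | zero => simp
  | succ k ih =>
    calc modulus f (2 ^ (k + 1) * t) = modulus f (2 * (2 ^ k * t)) := by congr 1; ring
      _ ≤ 4 * modulus f (2 ^ k * t) := modulus_two_mul_le hf _
      _ ≤ 4 * (4 ^ k * modulus f t) := by gcongr
      _ = 4 ^ (k + 1) * modulus f t := by ring

theorem setLIntegral_sq_le (hf : Measurable f) (s : Set ℝ) (t : ℝ) :
    ∫⁻ x in s, f x ^ 2 ≤ 2 * (∫⁻ x in s, f (x + t) ^ 2) + 2 * modulus f t := by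
  calc ∫⁻ x in s, f x ^ 2
      ≤ ∫⁻ x in s, (2 * f (x + t) ^ 2 + 2 * (f x - f (x + t)) ^ 2) :=
        lintegral_mono fun x => ENNReal.sq_le_two_mul_sq_add_tsub_sq _ _
    _ = 2 * (∫⁻ x in s, f (x + t) ^ 2) + 2 * ∫⁻ x in s, (f x - f (x + t)) ^ 2 := by
        rw [lintegral_add_left (by fun_prop), lintegral_const_mul _ (by fun_prop),
          lintegral_const_mul _ (by fun_prop)]
    _ ≤ _ := by
        gcongr
        exact setLIntegral_le_lintegral _ _

theorem setLIntegral_comp_add_right (g : ℝ → ℝ≥0∞) {s : Set ℝ} (hs : MeasurableSet s) (t : ℝ) :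
    ∫⁻ x in s, g (x + t) = ∫⁻ x in (fun x => x - t) ⁻¹' s, g x := by
  rw [← lintegral_indicator hs, ← lintegral_indicator (measurable_sub_const t hs),
    ← lintegral_add_right_eq_self (((fun x => x - t) ⁻¹' s).indicator g) t]
  refine lintegral_congr fun x => ?_
  have hx : x + t ∈ (fun x => x - t) ⁻¹' s ↔ x ∈ s := by
    rw [Set.mem_preimage, add_sub_cancel_right]
  by_cases h : x ∈ s
  · rw [Set.indicator_of_mem h, Set.indicator_of_mem (hx.2 h)]
  · rw [Set.indicator_of_notMem h, Set.indicator_of_notMem (mt hx.1 h)]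

/-- Distinct dyadic shifts differ by at least `2 ^ k₀ * |t|`, more than the length of the interval,
so its translates are disjoint. -/
theorem sum_setLIntegral_translates_le (f : ℝ → ℝ≥0∞) {R t : ℝ} {k₀ : ℕ}
    (ht : 2 * R < 2 ^ k₀ * |t|) (n : ℕ) :
    ∑ k ∈ Finset.range n, ∫⁻ x in Set.Icc (-R) R, f (x + 2 ^ (k₀ + k) * t) ^ 2 ≤
      ∫⁻ x, f x ^ 2 := by
  simp_rw [fun k => setLIntegral_comp_add_right (fun x => f x ^ 2)
    (measurableSet_Icc (a := -R) (b := R)) (2 ^ (k₀ + k) * t)]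
  rw [← lintegral_biUnion_finset]
  · exact setLIntegral_le_lintegral _ _
  · have key : ∀ i j : ℕ, i < j → ∀ x : ℝ, x - 2 ^ (k₀ + i) * t ∈ Set.Icc (-R) R →
        x - 2 ^ (k₀ + j) * t ∈ Set.Icc (-R) R → False := by
      intro i j hij x hi hj
      have h1 : |(2 ^ (k₀ + j) - 2 ^ (k₀ + i)) * t| ≤ 2 * R := by
        rw [abs_le]
        constructor <;> linarith [hi.1, hi.2, hj.1, hj.2]
      have h2 : (2 : ℝ) ^ (k₀ + (i + 1)) ≤ 2 ^ (k₀ + j) :=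
        pow_le_pow_right₀ (by norm_num) (by omega)
      have h3 : (2 : ℝ) ^ k₀ ≤ 2 ^ (k₀ + i) := pow_le_pow_right₀ (by norm_num) (by omega)
      have h4 : (2 : ℝ) ^ (k₀ + (i + 1)) = 2 * 2 ^ (k₀ + i) := by ring
      have h5 : (2 : ℝ) ^ k₀ ≤ 2 ^ (k₀ + j) - 2 ^ (k₀ + i) := by linarith
      rw [abs_mul, abs_of_nonneg (h5.trans' (by positivity))] at h1
      nlinarith [mul_le_mul_of_nonneg_right h5 (abs_nonneg t)]
    intro i _ j _ hij
    refine Set.disjoint_left.2 fun x hi hj => ?_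
    rcases lt_or_gt_of_ne hij with h | h
    · exact key i j h x hi hj
    · exact key j i h x hj hi
  · intro i _
    exact measurable_sub_const _ measurableSet_Icc

/-- If `f` hardly changes under translation by `t`, its mass on the window is nearly repeated, up to
a factor `2`, on disjoint dyadic translates, so it is a small share of the total. -/
theorem exists_setLIntegral_Icc_le {t₀ : ℝ} (ht₀ : 0 < t₀) (R : ℝ) :
    ∃ C : ℝ≥0∞, C ≠ ∞ ∧ ∀ f : ℝ → ℝ≥0∞, Measurable f → ∀ t : ℝ, t₀ ≤ |t| →
      ∫⁻ x in Set.Icc (-R) R, f x ^ 2 ≤ 4⁻¹ * (∫⁻ x, f x ^ 2) + C * modulus f t := by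
  obtain ⟨k₀, hk⟩ := pow_unbounded_of_one_lt (2 * R / t₀) (one_lt_two : (1 : ℝ) < 2)
  rw [div_lt_iff₀ ht₀] at hk
  -- Eight windows turn that factor `2` into `2 / 8 = 1 / 4`; the contraction needs a share below `1
  -- / 2`.
  refine ⟨8⁻¹ * (2 * ∑ k ∈ Finset.range 8, 4 ^ (k₀ + k)), ?_, fun f hf t ht => ?_⟩
  · refine ENNReal.mul_ne_top (by simp) (ENNReal.mul_ne_top (by simp) ?_)
    exact (ENNReal.sum_lt_top.2 fun k _ => ENNReal.pow_lt_top (by simp)).ne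
  have h := Finset.sum_le_sum fun k (_ : k ∈ Finset.range 8) =>
    (setLIntegral_sq_le hf (Set.Icc (-R) R) (2 ^ (k₀ + k) * t)).trans
      (add_le_add_right (mul_le_mul_right (modulus_two_pow_mul_le hf t (k₀ + k)) 2) _)
  rw [Finset.sum_const, Finset.card_range, Finset.sum_add_distrib, ← Finset.mul_sum,
    ← Finset.mul_sum, ← Finset.sum_mul] at h
  have h2 := sum_setLIntegral_translates_le f (R := R) (t := t) (k₀ := k₀)
    (hk.trans_le (by gcongr)) 8
  have h3 : (8 : ℝ≥0∞) * ∫⁻ x in Set.Icc (-R) R, f x ^ 2 ≤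
      2 * (∫⁻ x, f x ^ 2) + 2 * ((∑ k ∈ Finset.range 8, 4 ^ (k₀ + k)) * modulus f t) := by
    rw [nsmul_eq_mul] at h
    refine (h.trans ?_)
    gcongr
  have h8 : (8 : ℝ≥0∞)⁻¹ * 8 = 1 := ENNReal.inv_mul_cancel (by simp) (by simp)
  have h4 : (8 : ℝ≥0∞)⁻¹ * 2 = 4⁻¹ := by
    rw [show (8 : ℝ≥0∞) = 4 * 2 by norm_num, ENNReal.mul_inv (by simp) (by simp), mul_assoc,
      ENNReal.inv_mul_cancel (by simp) (by simp), mul_one]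
  calc ∫⁻ x in Set.Icc (-R) R, f x ^ 2
      = 8⁻¹ * (8 * ∫⁻ x in Set.Icc (-R) R, f x ^ 2) := by rw [← mul_assoc, h8, one_mul]
    _ ≤ 8⁻¹ * (2 * (∫⁻ x, f x ^ 2) +
          2 * ((∑ k ∈ Finset.range 8, 4 ^ (k₀ + k)) * modulus f t)) := by gcongr
    _ = _ := by rw [mul_add, ← mul_assoc, h4]; ring

/-- Averaging over nondegenerate random translations loses `L²` mass unless `f` has little mass
on bounded intervals. -/
theorem exists_setLIntegral_Icc_add_le [IsProbabilityMeasure σ] {t₀ : ℝ} (ht₀ : 0 < t₀)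
    (hσ : (σ.prod σ) {p | t₀ ≤ |p.2 - p.1|} ≠ 0) (R : ℝ) :
    ∃ C : ℝ≥0∞, C ≠ ∞ ∧ ∀ f : ℝ → ℝ≥0∞, Measurable f →
      (∫⁻ x in Set.Icc (-R) R, f x ^ 2) + C * (∫⁻ x, avg σ f x ^ 2) ≤
        4⁻¹ * (∫⁻ x, f x ^ 2) + C * ∫⁻ x, f x ^ 2 := by
  obtain ⟨C, hC, h⟩ := exists_setLIntegral_Icc_le ht₀ R
  set p := (σ.prod σ) {p | t₀ ≤ |p.2 - p.1|} with hp
  have hp' : p ≠ ∞ := measure_ne_top _ _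
  have hmeas : MeasurableSet {p : ℝ × ℝ | t₀ ≤ |p.2 - p.1|} :=
    measurableSet_le measurable_const (by fun_prop)
  refine ⟨p⁻¹ * (C * 2), by simp [ENNReal.mul_eq_top, hC, hσ], fun f hf => ?_⟩
  have hm := measurable_modulus hf
  set m := ∫⁻ x in Set.Icc (-R) R, f x ^ 2
  set F := ∫⁻ x, f x ^ 2
  set G := ∫⁻ x, avg σ f x ^ 2
  -- Integrate the window bound only over pairs of shifts at distance at least `t₀`, a set of
  -- positive probability `p`.
  have h1 : p * m ≤ p * (4⁻¹ * F) + C * ∫⁻ p, modulus f (p.2 - p.1) ∂(σ.prod σ) := by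
    calc p * m = ∫⁻ _ in {p : ℝ × ℝ | t₀ ≤ |p.2 - p.1|}, m ∂(σ.prod σ) := by
          rw [setLIntegral_const, mul_comm]
      _ ≤ ∫⁻ q in {p : ℝ × ℝ | t₀ ≤ |p.2 - p.1|},
            (4⁻¹ * F + C * modulus f (q.2 - q.1)) ∂(σ.prod σ) :=
          setLIntegral_mono' hmeas fun q hq => h f hf _ hq
      _ ≤ _ := by
          rw [lintegral_add_left (by fun_prop), setLIntegral_const, mul_comm _ (_ : ℝ≥0∞)]
          gcongr
          rw [lintegral_const_mul _ (by fun_prop)]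
          gcongr
          exact Measure.restrict_le_self
  have h2 := lintegral_modulus_add_le (σ := σ) hf
  have h3 : p * m + C * (2 * G) ≤ p * (4⁻¹ * F) + C * (2 * F) := by
    calc _ ≤ p * (4⁻¹ * F) + C * (∫⁻ p, modulus f (p.2 - p.1) ∂(σ.prod σ)) + C * (2 * G) := by
          gcongr
      _ = p * (4⁻¹ * F) + C * ((∫⁻ p, modulus f (p.2 - p.1) ∂(σ.prod σ)) + 2 * G) := by ring
      _ ≤ _ := by gcongr
  have hpp : p⁻¹ * p = 1 := ENNReal.inv_mul_cancel hσ hp'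
  calc m + p⁻¹ * (C * 2) * G = p⁻¹ * (p * m + C * (2 * G)) := by
        rw [mul_add, ← mul_assoc p⁻¹ p, hpp]; ring
    _ ≤ p⁻¹ * (p * (4⁻¹ * F) + C * (2 * F)) := by gcongr
    _ = _ := by rw [mul_add, ← mul_assoc p⁻¹ p, hpp]; ring

theorem setLIntegral_avg_sq_le [IsProbabilityMeasure σ] (hf : Measurable f) {r D : ℝ}
    (hD : ∀ᵐ s ∂σ, |s| ≤ D) :
    ∫⁻ y in Set.Icc (-r) r, avg σ f y ^ 2 ≤ ∫⁻ x in Set.Icc (-(r + D)) (r + D), f x ^ 2 := by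
  calc ∫⁻ y in Set.Icc (-r) r, avg σ f y ^ 2
      ≤ ∫⁻ y in Set.Icc (-r) r, ∫⁻ s, f (y + s) ^ 2 ∂σ :=
        lintegral_mono fun y => avg_sq_le hf y
    _ = ∫⁻ s, (∫⁻ y in Set.Icc (-r) r, f (y + s) ^ 2) ∂σ :=
        lintegral_lintegral_swap (by fun_prop)
    _ ≤ ∫⁻ _, (∫⁻ x in Set.Icc (-(r + D)) (r + D), f x ^ 2) ∂σ := by
        refine lintegral_mono_ae (hD.mono fun s hs => ?_)
        rw [setLIntegral_comp_add_right (fun x => f x ^ 2) measurableSet_Icc]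
        refine lintegral_mono_set fun x hx => ?_
        have := abs_le.1 hs
        exact ⟨by linarith [hx.1, this.1], by linarith [hx.2, this.2]⟩
    _ = _ := by simp

/-- `h` is obtained from `g` by the unitary action of `x ↦ -1/x` on functions on the line. -/
def IsInversion (g h : ℝ → ℝ≥0∞) : Prop :=
  ∀ x, x ≠ 0 → h x = ENNReal.ofReal |x|⁻¹ * g (-x⁻¹)

/-- The Jacobian `x⁻²` of `x ↦ -1/x` is the square of the weight `|x|⁻¹`. -/
theorem IsInversion.setLIntegral_image {g h : ℝ → ℝ≥0∞} (hgh : IsInversion g h) {s : Set ℝ}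
    (hs : MeasurableSet s) (h0 : (0 : ℝ) ∉ s) :
    ∫⁻ x in (fun x => -x⁻¹) '' s, g x ^ 2 = ∫⁻ x in s, h x ^ 2 := by
  have hne : ∀ x ∈ s, x ≠ 0 := fun x hx h => h0 (h ▸ hx)
  rw [lintegral_image_eq_lintegral_abs_deriv_mul hs (f' := fun x => (x ^ 2)⁻¹)]
  · refine setLIntegral_congr_fun hs fun x hx => ?_
    rw [hgh x (hne x hx), mul_pow, ← ENNReal.ofReal_pow (by positivity)]
    congr 2
    rw [abs_inv, abs_pow, sq_abs, inv_pow, sq_abs]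
  · intro x hx
    simpa only [neg_neg] using ((hasDerivAt_inv (hne x hx)).fun_neg).hasDerivWithinAt
  · intro x _ y _ hxy
    simpa using hxy

theorem IsInversion.lintegral_sq {g h : ℝ → ℝ≥0∞} (hgh : IsInversion g h) :
    ∫⁻ x, g x ^ 2 = ∫⁻ x, h x ^ 2 := by
  have h1 : (fun x : ℝ => -x⁻¹) '' {0}ᶜ = {0}ᶜ := by
    ext y
    constructor
    · rintro ⟨x, hx, rfl⟩
      simpa using hx
    · intro hy
      exact ⟨-y⁻¹, by simpa using hy, by simp⟩
  have h2 := hgh.setLIntegral_image (measurableSet_singleton (0 : ℝ)).compl (by simp)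
  rwa [h1, restrict_compl_singleton] at h2

theorem IsInversion.lintegral_sq_le {g h : ℝ → ℝ≥0∞} (hgh : IsInversion g h) :
    ∫⁻ x, g x ^ 2 ≤ (∫⁻ x in Set.Icc (-1) 1, g x ^ 2) + ∫⁻ x in Set.Icc (-1) 1, h x ^ 2 := by
  have h2 := hgh.setLIntegral_image
    ((measurableSet_Icc (a := (-1 : ℝ)) (b := 1)).diff (measurableSet_singleton (0 : ℝ))) (by simp)
  rw [← lintegral_add_compl _ (measurableSet_Icc : MeasurableSet (Set.Icc (-1 : ℝ) 1))]
  refine add_le_add_right ?_ _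
  calc ∫⁻ x in (Set.Icc (-1 : ℝ) 1)ᶜ, g x ^ 2
      ≤ ∫⁻ x in (fun x => -x⁻¹) '' (Set.Icc (-1) 1 \ {0}), g x ^ 2 := by
        refine lintegral_mono_set fun y hy => ?_
        have hy1 : 1 < |y| := by
          by_contra hle
          exact hy (abs_le.1 (not_lt.1 hle))
        have hy0 : y ≠ 0 := by
          rintro rfl
          norm_num at hy1
        refine ⟨-y⁻¹, ⟨abs_le.1 ?_, by simpa using hy0⟩, by simp⟩
        rw [abs_neg, abs_inv]
        exact inv_le_one_of_one_le₀ hy1.le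
    _ = ∫⁻ x in Set.Icc (-1) 1 \ {0}, h x ^ 2 := h2
    _ ≤ _ := lintegral_mono_set Set.sdiff_subset

/-- Two averaging steps separated by an inversion contract `L²` uniformly. -/
theorem exists_contraction [IsProbabilityMeasure σ] {t₀ D : ℝ} (ht₀ : 0 < t₀)
    (hσ : (σ.prod σ) {p | t₀ ≤ |p.2 - p.1|} ≠ 0) (hD : ∀ᵐ s ∂σ, |s| ≤ D) :
    ∃ ρ : ℝ, 0 < ρ ∧ ρ < 1 ∧ ∀ f h : ℝ → ℝ≥0∞, Measurable f → Measurable h →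
      IsInversion (avg σ f) h →
      ∫⁻ x, avg σ h x ^ 2 ≤ ENNReal.ofReal ρ * ∫⁻ x, f x ^ 2 := by
  -- Radius `1 + D`, because the average on `[-1, 1]` sees `f` only on `[-(1 + D), 1 + D]`.
  obtain ⟨C₁, hC₁, H₁⟩ := exists_setLIntegral_Icc_add_le ht₀ hσ (1 + D)
  obtain ⟨C₂, hC₂, H₂⟩ := exists_setLIntegral_Icc_add_le ht₀ hσ 1
  lift C₁ to NNReal using hC₁
  lift C₂ to NNReal using hC₂
  set C : ℝ := C₁ + C₂ with hC
  have hC0 : 0 ≤ C := by positivity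
  -- With `K ≤ G ≤ F` the masses after two, one and no averagings, the two window bounds add up to
  -- `(C + 3/4) K ≤ (C + 1/4) F`.
  refine ⟨(C + 1 / 4) / (C + 3 / 4), by positivity, ?_, fun f h hf hh hfh => ?_⟩
  · rw [div_lt_one (by positivity)]
    linarith
  have hKG := lintegral_avg_sq_le (σ := σ) hh
  have hGF := lintegral_avg_sq_le (σ := σ) hf
  have h1 := H₁ f hf
  have h2 := H₂ h hh
  -- The intermediate mass lies in `[-1, 1]` either before or after the inversion, so one of the two
  -- averagings must act on it effectively.
  have h3 := hfh.lintegral_sq_le.trans (add_le_add_left (setLIntegral_avg_sq_le hf hD) _)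
  rw [← hfh.lintegral_sq] at h2 hKG
  generalize (∫⁻ x, f x ^ 2) = F at h1 h2 h3 hKG hGF ⊢
  generalize (∫⁻ x, avg σ f x ^ 2) = G at h1 h2 h3 hKG hGF ⊢
  generalize (∫⁻ x, avg σ h x ^ 2) = K at h1 h2 h3 hKG hGF ⊢
  rcases eq_or_ne F ∞ with hF | hF
  · rw [hF, ENNReal.mul_top]
    · exact le_top
    · simp only [ne_eq, ENNReal.ofReal_eq_zero, not_le]
      positivity
  have hG : G ≠ ∞ := ne_top_of_le_ne_top hF hGF
  have hK : K ≠ ∞ := ne_top_of_le_ne_top hG hKG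
  have h4 : G + C₁ * G + C₂ * K ≤ 4⁻¹ * F + C₁ * F + (4⁻¹ * G + C₂ * G) := by
    refine le_trans ?_ (add_le_add h1 h2)
    refine (add_le_add_left (add_le_add_left h3 _) _).trans (le_of_eq ?_)
    ring
  lift F to NNReal using hF
  lift G to NNReal using hG
  lift K to NNReal using hK
  have e4 : (4⁻¹ : ℝ≥0∞) = ((4⁻¹ : NNReal) : ℝ≥0∞) := by
    rw [ENNReal.coe_inv (by norm_num)]
    norm_num
  rw [e4] at h4
  norm_cast at h4 hKG hGF
  have h4' : (G : ℝ) + C₁ * G + C₂ * K ≤ 4⁻¹ * F + C₁ * F + (4⁻¹ * G + C₂ * G) := by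
    exact_mod_cast h4
  have hKG' : (K : ℝ) ≤ G := by exact_mod_cast hKG
  have hGF' : (G : ℝ) ≤ F := by exact_mod_cast hGF
  rw [← ENNReal.ofReal_coe_nnreal, ← ENNReal.ofReal_coe_nnreal, ← ENNReal.ofReal_mul (by positivity)]
  apply ENNReal.ofReal_le_ofReal
  rw [div_mul_eq_mul_div, le_div_iff₀ (by positivity), hC]
  nlinarith [mul_nonneg C₂.2 (sub_nonneg.2 hGF'), mul_nonneg C₁.2 (sub_nonneg.2 hKG')]

end TranslationAverage

/-! ### Block decompositions and independence -/

namespace BoundedCocycle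

variable {Ω : Type*} [MeasurableSpace Ω] {μ : Measure Ω} {T : Ω → Ω} {c : ℝ} {g : ℕ → Ω → ℝ}

theorem le_sum_blocks (h : BoundedCocycle μ T c g) (k q r : ℕ) (ω : Ω) :
    g (q * k + r) ω ≤ ∑ j ∈ Finset.range q, g k (T^[j * k] ω) + r * c := by
  have h1 : g (q * k) ω ≤ ∑ j ∈ Finset.range q, g k (T^[j * k] ω) := by
    induction q with
    | zero => simpa using h.le_mul 0 ω
    | succ q ih =>
      rw [Finset.sum_range_succ, Nat.succ_mul]
      exact (h.add_le _ _ _).trans (add_le_add_left ih _)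
  exact (h.add_le _ _ _).trans (add_le_add h1 (h.le_mul _ _))

/-- The upper growth rate is at most the mean over consecutive blocks of length `k`. -/
theorem eventually_div_le (h : BoundedCocycle μ T c g) {ω : Ω} {k : ℕ} (hk : 0 < k) {a b : ℝ}
    (hb : Tendsto (fun q : ℕ => (∑ j ∈ Finset.range q, g k (T^[j * k] ω)) / q) atTop (𝓝 b))
    (hab : b / k < a) : ∀ᶠ n in atTop, g n ω / n ≤ a := by
  have hc := h.c_nonneg ω
  have hk' : (0 : ℝ) < k := by exact_mod_cast hk
  have h1 : Tendsto (fun n : ℕ => (∑ j ∈ Finset.range (n / k), g k (T^[j * k] ω)) / (n / k : ℕ) / k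
      + k * c / n) atTop (𝓝 (b / k + 0)) :=
    ((hb.comp (Nat.tendsto_div_const_atTop hk.ne')).div_const _).add
      (tendsto_const_div_atTop_nhds_zero_nat _)
  rw [add_zero] at h1
  filter_upwards [h1.eventually (gt_mem_nhds hab), eventually_ge_atTop k] with n hn hkn
  refine le_trans ?_ hn.le
  have hn0 : (0 : ℝ) < n := by exact_mod_cast hk.trans_le hkn
  have hq : (0 : ℝ) < (n / k : ℕ) := by exact_mod_cast Nat.div_pos hkn hk
  set S := ∑ j ∈ Finset.range (n / k), g k (T^[j * k] ω)
  have hS : 0 ≤ S := Finset.sum_nonneg fun j _ => h.nonneg _ _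
  have h2 : g n ω ≤ S + k * c := by
    conv_lhs => rw [← Nat.div_add_mod' n k]
    refine (h.le_sum_blocks _ _ _ _).trans ?_
    gcongr
    exact (Nat.mod_lt _ hk).le
  have h3 : ((n / k : ℕ) : ℝ) * k ≤ n := by exact_mod_cast Nat.div_mul_le_self n k
  calc g n ω / n ≤ (S + k * c) / n := by gcongr
    _ = S / n + k * c / n := add_div _ _ _
    _ ≤ S / ((n / k : ℕ) * k) + k * c / n := by gcongr
    _ = _ := by rw [div_div]

theorem integral_mul_le (h : BoundedCocycle μ T c g) [IsFiniteMeasure μ] (m n : ℕ) :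
    ∫ ω, g (m * n) ω ∂μ ≤ m * ∫ ω, g n ω ∂μ := by
  have hi : ∀ j, Integrable (fun ω => g n (T^[j] ω)) μ := fun j =>
    (h.measurePreserving.iterate j).integrable_comp_of_integrable (h.integrable n)
  have he : ∀ j, ∫ ω, g n (T^[j] ω) ∂μ = ∫ ω, g n ω ∂μ := by
    intro j
    rw [← integral_map (h.measurePreserving.iterate j).measurable.aemeasurable
      (h.measurable n).aestronglyMeasurable, (h.measurePreserving.iterate j).map_eq]
  calc ∫ ω, g (m * n) ω ∂μ ≤ ∫ ω, ∑ j ∈ Finset.range m, g n (T^[j * n] ω) ∂μ :=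
        integral_mono (h.integrable _) (integrable_finsetSum _ fun j _ => hi _) fun ω => by
          simpa using h.le_sum_blocks n m 0 ω
    _ = _ := by
        rw [integral_finsetSum _ fun j _ => hi _]
        simp [he]

end BoundedCocycle

/-- Functions depending on disjoint finite sets of coordinates are independent under a product
measure. -/
theorem MeasureTheory.Measure.indepFun_infinitePi_of_dependsOn {ι : Type*} {X : ι → Type*}
    {mX : ∀ i, MeasurableSpace (X i)} (P : ∀ i, Measure (X i)) [∀ i, IsProbabilityMeasure (P i)]
    {β γ : Type*} [MeasurableSpace β] [MeasurableSpace γ] {f : (∀ i, X i) → β}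
    {g : (∀ i, X i) → γ} (hf : Measurable f) (hg : Measurable g) {S T : Finset ι}
    (hfS : DependsOn f S) (hgT : DependsOn g T) (hST : Disjoint S T) :
    ProbabilityTheory.IndepFun f g (Measure.infinitePi P) := by
  classical
  have hne : ∀ i, Nonempty (X i) := fun i => (P i).nonempty_of_neZero
  -- Filling the other coordinates from an arbitrary `ω₀` factors `f` and `g` through finitely many
  -- coordinates.
  let ω₀ : ∀ i, X i := fun i => (hne i).some
  let ext (U : Finset ι) (y : ∀ i : U, X i) : ∀ i, X i :=
    fun i => if hi : i ∈ U then y ⟨i, hi⟩ else ω₀ i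
  have hext : ∀ U, Measurable (ext U) := by
    intro U
    refine measurable_pi_lambda _ fun i => ?_
    by_cases hi : i ∈ U
    · simpa only [ext, hi, dite_true] using measurable_pi_apply _
    · simpa only [ext, hi, dite_false] using measurable_const
  have hi := ((ProbabilityTheory.iIndepFun_infinitePi (P := P) (X := fun _ ω => ω)
    fun _ => measurable_id).indepFun_finset S T hST fun i => measurable_pi_apply i).comp
    (hf.comp (hext S)) (hg.comp (hext T))
  convert hi using 1
  · funext ω
    exact hfS fun i hi => by simp [ext, Finset.mem_coe.1 hi]
  · funext ω
    exact hgT fun i hi => by simp [ext, Finset.mem_coe.1 hi]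

/-! ### The transfer-matrix cocycle and almost sure convergence -/

namespace Anderson

/-- The operator norm of a real `2 × 2` matrix with respect to the Euclidean norm. -/
noncomputable def opNorm (M : Matrix (Fin 2) (Fin 2) ℝ) : ℝ :=
  ‖Matrix.toEuclideanCLM (n := Fin 2) (𝕜 := ℝ) M‖

theorem opNorm_mul_le (M N : Matrix (Fin 2) (Fin 2) ℝ) :
    opNorm (M * N) ≤ opNorm M * opNorm N := by
  simp only [opNorm, map_mul]
  exact norm_mul_le _ _

theorem norm_toLp_mulVec_le (M : Matrix (Fin 2) (Fin 2) ℝ) (v : Fin 2 → ℝ) :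
    ‖WithLp.toLp 2 (M.mulVec v)‖ ≤ opNorm M * ‖WithLp.toLp 2 v‖ :=
  (Matrix.toEuclideanCLM (n := Fin 2) (𝕜 := ℝ) M).le_opNorm (WithLp.toLp 2 v)

theorem continuous_opNorm : Continuous opNorm :=
  (LinearMap.continuous_of_finiteDimensional
    (Matrix.toEuclideanCLM (n := Fin 2) (𝕜 := ℝ)).toAlgEquiv.toLinearMap).norm

theorem one_le_opNorm {M : Matrix (Fin 2) (Fin 2) ℝ} (hM : M.det = 1) : 1 ≤ opNorm M := by
  have h0 := norm_toLp_mulVec_le M ![1, 0]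
  have h1 := norm_toLp_mulVec_le M ![0, 1]
  have hn : 0 ≤ opNorm M := norm_nonneg _
  simp only [EuclideanSpace.norm_eq, Fin.sum_univ_two, Real.norm_eq_abs, sq_abs, Matrix.mulVec,
    dotProduct, Matrix.cons_val_zero, Matrix.cons_val_one] at h0 h1
  norm_num at h0 h1
  rw [Real.sqrt_le_left hn] at h0 h1
  rw [Matrix.det_fin_two] at hM
  by_contra! hlt
  have h2 : opNorm M ^ 2 < 1 := pow_lt_one₀ hn hlt two_ne_zero
  -- Twice the determinant is at most the sum of the squared entries, which is at most twice the
  -- squared norm by the two column bounds.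
  nlinarith [sq_nonneg (M 0 0 - M 1 1), sq_nonneg (M 0 1 + M 1 0)]

theorem det_stepMatrix (E v : ℝ) : (stepMatrix E v).det = 1 := by
  simp [stepMatrix, Matrix.det_fin_two]

theorem continuous_stepMatrix (E : ℝ) : Continuous (stepMatrix E) := by
  unfold stepMatrix
  refine continuous_matrix fun i j => ?_
  fin_cases i <;> fin_cases j <;> simp <;> fun_prop

variable {ν : Measure ℝ}

theorem det_transferMatrix (E : ℝ) (ω : PhaseSpace ν) (n : ℕ) :
    (transferMatrix E ω n).det = 1 := by
  induction n with
  | zero => simp [transferMatrix]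
  | succ n ih => rw [transferMatrix, Matrix.det_mul, ih, det_stepMatrix, one_mul]

theorem continuous_transferMatrix (E : ℝ) (n : ℕ) :
    Continuous fun ω : PhaseSpace ν => transferMatrix E ω n := by
  induction n with
  | zero => exact continuous_const
  | succ n ih =>
    have : Continuous fun ω : PhaseSpace ν => potential ω ((n : ℤ) + 1) := by
      unfold potential
      fun_prop
    exact ((continuous_stepMatrix E).comp this).matrix_mul ih

theorem one_le_opNorm_transferMatrix (E : ℝ) (ω : PhaseSpace ν) (n : ℕ) :
    1 ≤ opNorm (transferMatrix E ω n) := one_le_opNorm (det_transferMatrix E ω n)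

theorem logNorm_eq (E : ℝ) (n : ℕ) (ω : PhaseSpace ν) :
    logNorm E n ω = Real.log (opNorm (transferMatrix E ω n)) := rfl

theorem logNorm_nonneg (E : ℝ) (n : ℕ) (ω : PhaseSpace ν) : 0 ≤ logNorm E n ω :=
  Real.log_nonneg (one_le_opNorm_transferMatrix E ω n)

theorem continuous_logNorm (E : ℝ) (n : ℕ) :
    Continuous fun ω : PhaseSpace ν => logNorm E n ω :=
  (continuous_opNorm.comp (continuous_transferMatrix E n)).log fun ω =>
    (one_pos.trans_le (one_le_opNorm_transferMatrix E ω n)).ne'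

instance [IsProbabilityMeasure ν] : IsProbabilityMeasure (law ν) :=
  inferInstanceAs (IsProbabilityMeasure (Measure.infinitePi _))

/-- The shift on the phase space. -/
def shift (ω : PhaseSpace ν) : PhaseSpace ν := fun n => ω (n + 1)

theorem shift_iterate_apply (m : ℕ) (ω : PhaseSpace ν) (n : ℤ) : shift^[m] ω n = ω (n + m) := by
  induction m generalizing ω with
  | zero => simp
  | succ m ih =>
    rw [Function.iterate_succ_apply, ih, shift]
    push_cast
    ring_nf

theorem measurePreserving_shift [IsProbabilityMeasure ν] :
    MeasurePreserving (shift (ν := ν)) (law ν) (law ν) := by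
  refine ⟨measurable_pi_lambda _ fun n => measurable_pi_apply _, ?_⟩
  exact Measure.map_infinitePi_infinitePi_of_inj (P := fun _ : ℤ => singleSite ν)
    (f := fun n : ℤ => n + 1) (add_left_injective 1)

theorem transferMatrix_add (E : ℝ) (ω : PhaseSpace ν) (m n : ℕ) :
    transferMatrix E ω (m + n) = transferMatrix E (shift^[m] ω) n * transferMatrix E ω m := by
  induction n with
  | zero => simp [transferMatrix]
  | succ n ih =>
    have h : potential (shift^[m] ω) ((n : ℤ) + 1) = potential ω (((m + n : ℕ) : ℤ) + 1) := by
      rw [potential, potential, shift_iterate_apply]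
      congr 2
      push_cast
      ring
    rw [← add_assoc, transferMatrix, ih, transferMatrix, Matrix.mul_assoc, h]

theorem dependsOn_transferMatrix (E : ℝ) (n : ℕ) :
    DependsOn (fun ω : PhaseSpace ν => transferMatrix E ω n) (Finset.Ioc (0 : ℤ) n) := by
  induction n with
  | zero => exact fun _ _ _ => rfl
  | succ n ih =>
    intro x y hxy
    have h1 := ih (x := x) (y := y) fun i hi => hxy i (by
      simp only [Finset.coe_Ioc, Set.mem_Ioc] at hi ⊢
      push_cast
      omega)
    have h2 := hxy (n + 1) (by
      simp only [Finset.coe_Ioc, Set.mem_Ioc]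
      push_cast
      omega)
    simp only [transferMatrix, potential, h2] at h1 ⊢
    rw [h1]

theorem dependsOn_logNorm_shift (E : ℝ) (m n : ℕ) :
    DependsOn (fun ω : PhaseSpace ν => logNorm E n (shift^[m] ω))
      (Finset.Ioc (m : ℤ) (m + n)) := by
  intro x y hxy
  have h := dependsOn_transferMatrix (ν := ν) E n (x := shift^[m] x) (y := shift^[m] y)
    fun i hi => by
      rw [shift_iterate_apply, shift_iterate_apply]
      refine hxy _ ?_
      simp only [Finset.coe_Ioc, Set.mem_Ioc] at hi ⊢
      omega
  simp only [logNorm_eq]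
  exact congrArg (fun M => Real.log (opNorm M)) h

theorem exists_opNorm_le (hcompact : IsCompact ν.support) (E : ℝ) :
    ∃ K : ℝ, 1 ≤ K ∧ ∀ v ∈ ν.support, opNorm (stepMatrix E v) ≤ K ∧
      ∃ B, stepMatrix E v * B = 1 ∧ opNorm B ≤ K := by
  have hinv : Continuous fun v : ℝ => (!![0, 1; -1, E - v] : Matrix (Fin 2) (Fin 2) ℝ) := by
    refine continuous_matrix fun i j => ?_
    fin_cases i <;> fin_cases j <;> simp <;> fun_prop
  obtain ⟨K₁, h₁⟩ := hcompact.bddAbove_image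
    (continuous_opNorm.comp (continuous_stepMatrix E)).continuousOn
  obtain ⟨K₂, h₂⟩ := hcompact.bddAbove_image (continuous_opNorm.comp hinv).continuousOn
  refine ⟨max 1 (max K₁ K₂), le_max_left _ _, fun v hv =>
    ⟨?_, !![0, 1; -1, E - v], ?_, ?_⟩⟩
  · exact (h₁ ⟨v, hv, rfl⟩).trans ((le_max_left _ _).trans (le_max_right _ _))
  · ext i j
    fin_cases i <;> fin_cases j <;> simp [stepMatrix, Matrix.mul_apply, Fin.sum_univ_two]
  · exact (h₂ ⟨v, hv, rfl⟩).trans ((le_max_right _ _).trans (le_max_right _ _))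

theorem opNorm_one : opNorm 1 = 1 := by simp [opNorm]

theorem exists_boundedCocycle [IsProbabilityMeasure ν] (hcompact : IsCompact ν.support) (E : ℝ) :
    ∃ c, BoundedCocycle (law ν) shift c (fun n ω => logNorm (ν := ν) E n ω) := by
  obtain ⟨K, hK1, hK⟩ := exists_opNorm_le hcompact E
  have hK0 : 0 < K := one_pos.trans_le hK1
  have hpos : ∀ (n : ℕ) (ω : PhaseSpace ν), 0 < opNorm (transferMatrix E ω n) :=
    fun n ω => one_pos.trans_le (one_le_opNorm_transferMatrix E ω n)
  refine ⟨Real.log K, measurePreserving_shift, fun n => (continuous_logNorm E n).measurable,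
    logNorm_nonneg E, fun n ω => ?_, fun m n ω => ?_, fun n ω => ?_⟩
  · rw [logNorm_eq, ← Real.log_pow]
    refine Real.log_le_log (hpos n ω) ?_
    induction n with
    | zero => simp [transferMatrix, opNorm_one]
    | succ n ih =>
      rw [transferMatrix, pow_succ']
      exact (opNorm_mul_le _ _).trans
        (mul_le_mul (hK _ (ω _).2).1 ih (hpos n ω).le hK0.le)
  · rw [logNorm_eq, logNorm_eq, logNorm_eq, ← Real.log_mul (hpos _ _).ne' (hpos _ _).ne',
      transferMatrix_add]
    rw [mul_comm (opNorm _)]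
    refine Real.log_le_log ?_ (opNorm_mul_le _ _)
    rw [← transferMatrix_add]
    exact hpos _ _
  · rw [logNorm_eq, logNorm_eq, ← Real.log_mul (hpos _ _).ne' hK0.ne']
    refine Real.log_le_log (hpos _ _) ?_
    -- Shifting the base point removes the rightmost factor, that is, multiplies by its inverse `B`.
    obtain ⟨B, hB, hBK⟩ := (hK _ (ω 1).2).2
    have h1 : transferMatrix E ω 1 = stepMatrix E (ω 1) := by
      simp [transferMatrix, potential]
    have h2 : transferMatrix E (shift ω) n = transferMatrix E ω (n + 1) * B := by
      rw [add_comm n 1, transferMatrix_add, h1, Matrix.mul_assoc, hB, Matrix.mul_one,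
        Function.iterate_one]
    rw [h2]
    exact (opNorm_mul_le _ _).trans (mul_le_mul_of_nonneg_left hBK (hpos _ _).le)

/-- Consecutive blocks read disjoint windows of sites, so the strong law of large numbers serves in
place of an ergodic theorem. -/
theorem tendsto_block_average [IsProbabilityMeasure ν] {c E : ℝ}
    (h : BoundedCocycle (law ν) shift c (fun n ω => logNorm (ν := ν) E n ω)) (k : ℕ) :
    ∀ᵐ ω ∂(law ν), Tendsto (fun q : ℕ =>
      (∑ j ∈ Finset.range q, logNorm E k (shift^[j * k] ω)) / (q : ℝ)) atTop
      (𝓝 (∫ ω, logNorm E k ω ∂(law ν))) := by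
  have hm : ∀ j, MeasurePreserving (shift (ν := ν))^[j] (law ν) (law ν) :=
    fun j => measurePreserving_shift.iterate j
  have key := ProbabilityTheory.strong_law_ae_real (μ := law ν)
    (fun j ω => logNorm E k (shift^[j * k] ω)) (by simpa using h.integrable k) ?_ ?_
  · simpa using key
  · have aux : ∀ i j : ℕ, i < j → Disjoint (Finset.Ioc ((i * k : ℕ) : ℤ) ((i * k : ℕ) + k))
        (Finset.Ioc ((j * k : ℕ) : ℤ) ((j * k : ℕ) + k)) := by
      intro i j hij
      refine Finset.disjoint_left.2 fun x hx hy => ?_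
      rw [Finset.mem_Ioc] at hx hy
      have : (i + 1) * k ≤ j * k := Nat.mul_le_mul_right k hij
      rw [Nat.succ_mul] at this
      omega
    intro i j hij
    refine Measure.indepFun_infinitePi_of_dependsOn (fun _ : ℤ => singleSite ν)
      ((h.measurable k).comp (hm _).measurable) ((h.measurable k).comp (hm _).measurable)
      (dependsOn_logNorm_shift E _ k) (dependsOn_logNorm_shift E _ k) ?_
    rcases lt_or_gt_of_ne hij with hlt | hlt
    · exact aux i j hlt
    · exact (aux j i hlt).symm
  · intro i
    have h1 : ∀ j, ProbabilityTheory.IdentDistrib (fun ω => logNorm E k (shift^[j] ω))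
        (fun ω => logNorm (ν := ν) E k ω) (law ν) (law ν) := fun j =>
      ⟨((h.measurable k).comp (hm j).measurable).aemeasurable, (h.measurable k).aemeasurable, by
        conv_rhs => rw [← (hm j).map_eq, Measure.map_map (h.measurable k) (hm j).measurable]
        rfl⟩
    simpa using h1 (i * k)

theorem bddBelow_range (E : ℝ) [IsProbabilityMeasure ν] : BddBelow (Set.range
    fun n : Set.Ici (1 : ℕ) => (1 / ((n : ℕ) : ℝ)) * ∫ ω, logNorm E (n : ℕ) ω ∂(law ν)) := by
  refine ⟨0, ?_⟩
  rintro _ ⟨n, rfl⟩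
  exact mul_nonneg (by positivity) (integral_nonneg fun ω => logNorm_nonneg E n ω)

theorem ae_hasLyapunovBehavior [IsProbabilityMeasure ν] (hcompact : IsCompact ν.support) (E : ℝ) :
    ∀ᵐ ω ∂(law ν), HasLyapunovBehavior E ω (lyapunovExponent ν E) := by
  obtain ⟨c, h⟩ := exists_boundedCocycle hcompact E
  have key := h.tendsto_div (γ := lyapunovExponent ν E) ?_ ?_
  · filter_upwards [key] with ω hω
    simpa [HasLyapunovBehavior, div_eq_inv_mul] using hω
  · intro n
    rcases Nat.eq_zero_or_pos n with rfl | hn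
    · simpa using integral_nonneg fun ω => logNorm_nonneg E 0 ω
    · have h1 := ciInf_le (bddBelow_range (ν := ν) E) (⟨n, hn⟩ : Set.Ici (1 : ℕ))
      have hn' : (0 : ℝ) < n := by exact_mod_cast hn
      rw [one_div_mul_eq_div, le_div_iff₀ hn'] at h1
      rw [mul_comm]
      exact h1
  · intro a ha
    obtain ⟨⟨k, hk⟩, hka⟩ := exists_lt_of_ciInf_lt ha
    filter_upwards [tendsto_block_average h k] with ω hω
    refine h.eventually_div_le (Nat.lt_of_lt_of_le one_pos hk) hω ?_
    rwa [one_div_mul_eq_div] at hka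

end Anderson

/-! ### Homogeneous functions and positivity of the exponent -/

namespace Anderson

open TranslationAverage

variable {ν : Measure ℝ}

/-- The distribution of `E - v` when `v` has distribution `ν`. -/
noncomputable def energyLaw (ν : Measure ℝ) (E : ℝ) : Measure ℝ := ν.map (E - ·)

instance (E : ℝ) [IsProbabilityMeasure ν] : IsProbabilityMeasure (energyLaw ν E) :=
  Measure.isProbabilityMeasure_map (by fun_prop)

theorem map_val_singleSite [IsProbabilityMeasure ν] : (singleSite ν).map Subtype.val = ν := by
  rw [singleSite, map_comap_subtype_coe ν.isClosed_support.measurableSet]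
  exact Measure.restrict_eq_self_of_ae_mem ν.support_mem_ae

theorem map_potential [IsProbabilityMeasure ν] (E : ℝ) (n : ℤ) :
    (law ν).map (fun ω => E - potential ω n) = energyLaw ν E := by
  have h1 : (law ν).map (fun ω => ω n) = singleSite ν :=
    Measure.infinitePi_map_eval (fun _ : ℤ => singleSite ν) n
  conv_rhs => rw [energyLaw, ← map_val_singleSite (ν := ν), ← h1]
  rw [Measure.map_map (by fun_prop) (by fun_prop), Measure.map_map (by fun_prop) (by fun_prop)]
  rfl

theorem exists_ae_abs_le [IsProbabilityMeasure ν] (hcompact : IsCompact ν.support) (E : ℝ) :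
    ∃ D, ∀ᵐ s ∂(energyLaw ν E), |s| ≤ D := by
  obtain ⟨D, hD⟩ := hcompact.bddAbove_image (f := fun v => |E - v|) (by fun_prop)
  refine ⟨D, (ae_map_iff (by fun_prop) (measurableSet_le (by fun_prop) measurable_const)).2 ?_⟩
  filter_upwards [ν.support_mem_ae] with v hv
  exact hD ⟨v, hv, rfl⟩

/-- Balls of radius `dist x y / 4` about the images of two support points have positive mass and
stay `dist x y / 2` apart. -/
theorem exists_prod_energyLaw_ne_zero [IsProbabilityMeasure ν] (hsupp : ν.support.Nontrivial)
    (E : ℝ) : ∃ t₀ : ℝ, 0 < t₀ ∧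
      ((energyLaw ν E).prod (energyLaw ν E)) {p | t₀ ≤ |p.2 - p.1|} ≠ 0 := by
  obtain ⟨x, hx, y, hy, hxy⟩ := hsupp
  have hd : 0 < dist x y := dist_pos.2 hxy
  have hball : ∀ z ∈ ν.support, 0 < energyLaw ν E (Metric.ball (E - z) (dist x y / 4)) := by
    intro z hz
    rw [energyLaw, Measure.map_apply (by fun_prop) measurableSet_ball]
    refine (Measure.mem_support_iff_forall z).1 hz _ ?_
    exact (by fun_prop : Continuous fun v : ℝ => E - v).continuousAt.preimage_mem_nhds
      (Metric.ball_mem_nhds _ (by positivity))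
  refine ⟨dist x y / 2, by positivity, fun h0 => ?_⟩
  have hsub : Metric.ball (E - x) (dist x y / 4) ×ˢ Metric.ball (E - y) (dist x y / 4) ⊆
      {p : ℝ × ℝ | dist x y / 2 ≤ |p.2 - p.1|} := by
    rintro ⟨a, b⟩ ⟨ha, hb⟩
    have h1 : dist (E - x) (E - y) ≤ dist (E - x) a + dist a b + dist b (E - y) :=
      dist_triangle4 _ _ _ _
    rw [dist_sub_left] at h1
    have h2 : dist a (E - x) < dist x y / 4 := ha
    have h3 : dist b (E - y) < dist x y / 4 := hb
    rw [dist_comm (E - x) a] at h1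
    have h4 : dist a b = |b - a| := by rw [dist_comm, Real.dist_eq]
    rw [h4] at h1
    change dist x y / 2 ≤ |b - a|
    linarith
  have h1 := measure_mono_null hsub h0
  rw [Measure.prod_prod] at h1
  exact (mul_ne_zero (hball x hx).ne' (hball y hy).ne') h1

/-- The Markov operator `φ ↦ (w ↦ 𝔼 φ(A w))` of the random one-step matrix `A`. -/
noncomputable def markov (σ : Measure ℝ) (φ : (Fin 2 → ℝ) → ℝ≥0∞) (w : Fin 2 → ℝ) : ℝ≥0∞ :=
  ∫⁻ s, φ ((stepMatrix s 0).mulVec w) ∂σ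

theorem measurable_stepMatrix_mulVec :
    Measurable fun p : (Fin 2 → ℝ) × ℝ => (stepMatrix p.2 0).mulVec p.1 := by
  refine measurable_pi_lambda _ fun i => ?_
  fin_cases i <;> simp [stepMatrix, Matrix.mulVec, dotProduct] <;> fun_prop

theorem measurable_markov {σ : Measure ℝ} [SFinite σ] {φ : (Fin 2 → ℝ) → ℝ≥0∞}
    (hφ : Measurable φ) : Measurable (markov σ φ) :=
  Measurable.lintegral_prod_right' (hφ.comp measurable_stepMatrix_mulVec)

theorem measurable_markov_iterate {σ : Measure ℝ} [SFinite σ] {φ : (Fin 2 → ℝ) → ℝ≥0∞}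
    (hφ : Measurable φ) (n : ℕ) : Measurable ((markov σ)^[n] φ) := by
  induction n with
  | zero => exact hφ
  | succ n ih =>
    rw [Function.iterate_succ_apply']
    exact measurable_markov ih

/-- The newest factor stands on the left and is independent of the rest; integrating it out replaces
`φ` by `markov φ`, so the induction runs over all `φ`. -/
theorem lintegral_transferMatrix_mulVec [IsProbabilityMeasure ν] (E : ℝ) (n : ℕ)
    {φ : (Fin 2 → ℝ) → ℝ≥0∞} (hφ : Measurable φ) (v : Fin 2 → ℝ) :
    ∫⁻ ω, φ ((transferMatrix E ω n).mulVec v) ∂(law ν) = (markov (energyLaw ν E))^[n] φ v := by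
  induction n generalizing φ with
  | zero => simp [transferMatrix]
  | succ n ih =>
    have hX : Measurable fun ω : PhaseSpace ν => (transferMatrix E ω n).mulVec v :=
      ((continuous_transferMatrix E n).matrix_mulVec continuous_const).measurable
    have hY : Measurable fun ω : PhaseSpace ν => E - potential ω ((n : ℤ) + 1) := by
      unfold potential
      fun_prop
    have hind : ProbabilityTheory.IndepFun
        (fun ω : PhaseSpace ν => (transferMatrix E ω n).mulVec v)
        (fun ω : PhaseSpace ν => E - potential ω ((n : ℤ) + 1)) (law ν) := by
      refine Measure.indepFun_infinitePi_of_dependsOn (fun _ : ℤ => singleSite ν) hX hY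
        (S := Finset.Ioc 0 (n : ℤ)) (T := {(n : ℤ) + 1}) ?_ ?_ (by simp)
      · exact fun x y hxy => congrArg (Matrix.mulVec · v) (dependsOn_transferMatrix E n hxy)
      · intro x y hxy
        simp only [potential]
        rw [hxy ((n : ℤ) + 1) (by simp)]
    have hstep : ∀ ω : PhaseSpace ν, (transferMatrix E ω (n + 1)).mulVec v =
        (stepMatrix (E - potential ω ((n : ℤ) + 1)) 0).mulVec ((transferMatrix E ω n).mulVec v) := by
      intro ω
      rw [Matrix.mulVec_mulVec, transferMatrix]
      simp [stepMatrix]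
    have hφ' : Measurable fun p : (Fin 2 → ℝ) × ℝ => φ ((stepMatrix p.2 0).mulVec p.1) :=
      hφ.comp measurable_stepMatrix_mulVec
    rw [Function.iterate_succ_apply, ← ih (measurable_markov hφ)]
    calc ∫⁻ ω, φ ((transferMatrix E ω (n + 1)).mulVec v) ∂(law ν)
        = ∫⁻ p, φ ((stepMatrix p.2 0).mulVec p.1) ∂((law ν).map fun ω =>
            ((transferMatrix E ω n).mulVec v, E - potential ω ((n : ℤ) + 1))) := by
          rw [lintegral_map hφ' (hX.prodMk hY)]
          simp only [hstep]
      _ = ∫⁻ w, markov (energyLaw ν E) φ w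
            ∂((law ν).map fun ω => (transferMatrix E ω n).mulVec v) := by
          rw [(ProbabilityTheory.indepFun_iff_map_prod_eq_prod_map_map hX.aemeasurable
            hY.aemeasurable).1 hind, map_potential, lintegral_prod _ hφ'.aemeasurable]
          rfl
      _ = _ := lintegral_map (measurable_markov hφ) hX

/-- The reciprocal of the Euclidean norm. -/
noncomputable def invNorm (w : Fin 2 → ℝ) : ℝ≥0∞ := ‖WithLp.toLp 2 w‖ₑ⁻¹

theorem measurable_invNorm : Measurable invNorm :=
  (PiLp.continuous_toLp 2 fun _ : Fin 2 => ℝ).enorm.measurable.inv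

theorem markov_iterate_smul (σ : Measure ℝ) (n : ℕ) {c : ℝ} (hc : c ≠ 0) (w : Fin 2 → ℝ) :
    (markov σ)^[n] invNorm (c • w) = ENNReal.ofReal |c|⁻¹ * (markov σ)^[n] invNorm w := by
  induction n generalizing w with
  | zero =>
    simp only [Function.iterate_zero, id, invNorm, WithLp.toLp_smul, enorm_smul]
    rw [ENNReal.mul_inv (by simp [hc]) (by simp), ENNReal.ofReal_inv_of_pos (abs_pos.2 hc),
      Real.enorm_eq_ofReal_abs]
  | succ n ih =>
    simp only [Function.iterate_succ_apply', markov, Matrix.mulVec_smul, ih]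
    exact lintegral_const_mul' _ _ ENNReal.ofReal_ne_top

/-- The restriction of the iterates `𝔼 ‖M(n) w‖⁻¹` to the affine line `w = (x, 1)`. -/
noncomputable def profile (σ : Measure ℝ) (n : ℕ) (x : ℝ) : ℝ≥0∞ :=
  (markov σ)^[n] invNorm ![x, 1]

theorem measurable_profile {σ : Measure ℝ} [SFinite σ] (n : ℕ) : Measurable (profile σ n) := by
  refine (measurable_markov_iterate measurable_invNorm n).comp (measurable_pi_lambda _ fun i => ?_)
  fin_cases i
  · exact measurable_id
  · exact measurable_const

/-- The step matrix sends `(x, 1)` to `(s x - 1, x) = x • (s - x⁻¹, 1)`; homogeneity extracts the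
factor `|x|⁻¹`. -/
theorem isInversion_profile (σ : Measure ℝ) (n : ℕ) :
    IsInversion (avg σ (profile σ n)) (profile σ (n + 1)) := by
  intro x hx
  rw [profile, Function.iterate_succ_apply', markov, avg,
    ← lintegral_const_mul' _ _ ENNReal.ofReal_ne_top]
  refine lintegral_congr fun s => ?_
  rw [profile, ← markov_iterate_smul σ n hx]
  refine congrArg _ (funext fun i => ?_)
  fin_cases i
  · simp [stepMatrix, Matrix.mulVec, dotProduct]
    field_simp
    ring
  · simp [stepMatrix, Matrix.mulVec, dotProduct]

theorem lintegral_profile_zero_sq_lt_top (σ : Measure ℝ) : ∫⁻ x, profile σ 0 x ^ 2 < ∞ := by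
  have h : ∀ x, profile σ 0 x ^ 2 = ENNReal.ofReal ((1 + x ^ 2)⁻¹) := by
    intro x
    have hn : ‖WithLp.toLp 2 ![x, 1]‖ = √(1 + x ^ 2) := by
      simp [EuclideanSpace.norm_eq, Fin.sum_univ_two, add_comm]
    rw [profile, Function.iterate_zero, id, invNorm, ← ofReal_norm, hn,
      ← ENNReal.ofReal_inv_of_pos (by positivity), ← ENNReal.ofReal_pow (by positivity), inv_pow,
      Real.sq_sqrt (by positivity)]
  simp_rw [h]
  exact integrable_inv_one_add_sq.lintegral_lt_top

theorem exists_lintegral_profile_sq_le [IsProbabilityMeasure ν] (hcompact : IsCompact ν.support)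
    (hsupp : ν.support.Nontrivial) (E : ℝ) : ∃ ρ : ℝ, 0 < ρ ∧ ρ < 1 ∧ ∀ n,
      ∫⁻ x, profile (energyLaw ν E) (2 * n) x ^ 2 ≤
        ENNReal.ofReal (ρ ^ n) * ∫⁻ x, profile (energyLaw ν E) 0 x ^ 2 := by
  obtain ⟨t₀, ht₀, h₀⟩ := exists_prod_energyLaw_ne_zero hsupp E
  obtain ⟨D, hD⟩ := exists_ae_abs_le hcompact E
  obtain ⟨ρ, hρ0, hρ1, hρ⟩ := exists_contraction ht₀ h₀ hD
  refine ⟨ρ, hρ0, hρ1, fun n => ?_⟩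
  induction n with
  | zero => simp
  | succ n ih =>
    calc ∫⁻ x, profile (energyLaw ν E) (2 * (n + 1)) x ^ 2
        = ∫⁻ x, avg (energyLaw ν E) (profile (energyLaw ν E) (2 * n + 1)) x ^ 2 :=
          (isInversion_profile (energyLaw ν E) (2 * n + 1)).lintegral_sq.symm
      _ ≤ ENNReal.ofReal ρ * ∫⁻ x, profile (energyLaw ν E) (2 * n) x ^ 2 :=
          hρ _ _ (measurable_profile _) (measurable_profile _) (isInversion_profile _ _)
      _ ≤ ENNReal.ofReal ρ *
          (ENNReal.ofReal (ρ ^ n) * ∫⁻ x, profile (energyLaw ν E) 0 x ^ 2) := by gcongr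
      _ = _ := by
          rw [← mul_assoc, ← ENNReal.ofReal_mul hρ0.le, pow_succ']

/-- For `|x| ≤ 1` the vector `(x, 1)` has norm at most `2`, so the profile is at least `r / 2` on an
interval of length `2`. -/
theorem lintegral_inv_opNorm_sq_le [IsProbabilityMeasure ν] (E : ℝ) (n : ℕ) :
    (∫⁻ ω, (ENNReal.ofReal (opNorm (transferMatrix E ω n)))⁻¹ ∂(law ν)) ^ 2 ≤
      2 * ∫⁻ x, profile (energyLaw ν E) n x ^ 2 := by
  set r := ∫⁻ ω, (ENNReal.ofReal (opNorm (transferMatrix E ω n)))⁻¹ ∂(law ν)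
  have h1 : ∀ x ∈ Set.Icc (-1 : ℝ) 1, 2⁻¹ * r ≤ profile (energyLaw ν E) n x := by
    intro x hx
    have hv : ‖WithLp.toLp 2 ![x, 1]‖ ≤ 2 := by
      simp only [EuclideanSpace.norm_eq, Fin.sum_univ_two]
      rw [Real.sqrt_le_left (by norm_num)]
      simp
      nlinarith [hx.1, hx.2]
    rw [profile, ← lintegral_transferMatrix_mulVec E n measurable_invNorm,
      ← lintegral_const_mul' _ _ (by simp)]
    refine lintegral_mono fun ω => ?_
    have hpos := one_pos.trans_le (one_le_opNorm_transferMatrix E ω n)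
    rw [invNorm, ← ENNReal.mul_inv (by simp) (by simp)]
    refine ENNReal.inv_le_inv.2 ?_
    have h2 : 2 * ENNReal.ofReal (opNorm (transferMatrix E ω n)) =
        ENNReal.ofReal (2 * opNorm (transferMatrix E ω n)) := by
      rw [ENNReal.ofReal_mul (by norm_num), ENNReal.ofReal_ofNat]
    rw [← ofReal_norm, h2]
    refine ENNReal.ofReal_le_ofReal ((norm_toLp_mulVec_le _ _).trans ?_)
    nlinarith
  calc r ^ 2 = 2 * ((2⁻¹ * r) ^ 2 * 2) := by
        have : (2 : ℝ≥0∞)⁻¹ * 2 = 1 := ENNReal.inv_mul_cancel (by simp) (by simp)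
        calc r ^ 2 = (2⁻¹ * 2) * (2⁻¹ * 2) * r ^ 2 := by rw [this]; simp
          _ = _ := by ring
    _ = 2 * ∫⁻ _ in Set.Icc (-1 : ℝ) 1, (2⁻¹ * r) ^ 2 := by
        rw [setLIntegral_const, Real.volume_Icc]
        norm_num
    _ ≤ 2 * ∫⁻ x in Set.Icc (-1 : ℝ) 1, profile (energyLaw ν E) n x ^ 2 := by
        gcongr 2 * ?_
        exact setLIntegral_mono' measurableSet_Icc fun x hx => pow_le_pow_left' (h1 x hx) 2
    _ ≤ _ := by
        gcongr 2 * ?_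
        exact setLIntegral_le_lintegral _ _

/-- A form of Jensen's inequality for the logarithm. -/
theorem neg_log_le_integral_logNorm [IsProbabilityMeasure ν] (hcompact : IsCompact ν.support)
    (E : ℝ) (n : ℕ) {r : ℝ} (hr : 0 < r)
    (h : ∫⁻ ω, (ENNReal.ofReal (opNorm (transferMatrix E ω n)))⁻¹ ∂(law ν) ≤ ENNReal.ofReal r) :
    -Real.log r ≤ ∫ ω, logNorm E n ω ∂(law ν) := by
  obtain ⟨c, hc⟩ := exists_boundedCocycle hcompact E
  have hpos : ∀ ω : PhaseSpace ν, 0 < opNorm (transferMatrix E ω n) :=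
    fun ω => one_pos.trans_le (one_le_opNorm_transferMatrix E ω n)
  have hcont : Continuous fun ω : PhaseSpace ν => (opNorm (transferMatrix E ω n))⁻¹ :=
    (continuous_opNorm.comp (continuous_transferMatrix E n)).inv₀ fun ω => (hpos ω).ne'
  have hint : Integrable (fun ω : PhaseSpace ν => (opNorm (transferMatrix E ω n))⁻¹) (law ν) :=
    Integrable.of_mem_Icc 0 1 hcont.measurable.aemeasurable (Eventually.of_forall fun ω =>
      ⟨(inv_pos.2 (hpos ω)).le, inv_le_one_of_one_le₀ (one_le_opNorm_transferMatrix E ω n)⟩)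
  have hle : ∫ ω, (opNorm (transferMatrix E ω n))⁻¹ ∂(law ν) ≤ r := by
    rw [← ENNReal.ofReal_le_ofReal_iff hr.le, ofReal_integral_eq_lintegral_ofReal hint
      (Eventually.of_forall fun ω => (inv_pos.2 (hpos ω)).le)]
    simpa only [ENNReal.ofReal_inv_of_pos (hpos _)] using h
  have hpt : ∀ ω : PhaseSpace ν,
      1 - Real.log r - r⁻¹ * (opNorm (transferMatrix E ω n))⁻¹ ≤ logNorm E n ω := by
    intro ω
    -- The tangent-line bound `1 - y⁻¹ ≤ log y` at `y = r ‖M‖`.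
    have h1 := Real.one_sub_inv_le_log_of_pos (mul_pos hr (hpos ω))
    rw [Real.log_mul hr.ne' (hpos ω).ne', mul_inv] at h1
    rw [logNorm_eq]
    linarith
  have h2 := integral_mono ((integrable_const _).sub (hint.const_mul r⁻¹)) (hc.integrable n) hpt
  simp only [Pi.sub_apply] at h2
  rw [integral_sub (integrable_const _) (hint.const_mul _), integral_const_mul] at h2
  have h3 : r⁻¹ * ∫ ω, (opNorm (transferMatrix E ω n))⁻¹ ∂(law ν) ≤ 1 := by
    rw [inv_mul_le_iff₀ hr, mul_one]
    exact hle
  simp only [integral_const, probReal_univ, one_smul] at h2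
  linarith

theorem exists_linear_lower_bound [IsProbabilityMeasure ν] (hcompact : IsCompact ν.support)
    (hsupp : ν.support.Nontrivial) (E : ℝ) : ∃ δ B : ℝ, 0 < δ ∧ ∀ n : ℕ,
      δ * n - B ≤ ∫ ω, logNorm E (2 * n) ω ∂(law ν) := by
  obtain ⟨ρ, hρ0, hρ1, hρ⟩ := exists_lintegral_profile_sq_le hcompact hsupp E
  set F := ∫⁻ x, profile (energyLaw ν E) 0 x ^ 2 with hF
  have hFtop : F ≠ ∞ := (lintegral_profile_zero_sq_lt_top _).ne
  set b : ℝ := 2 * F.toReal + 1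
  have hb : 0 < b := by positivity
  -- The halves come from the square root that passes from squared `L²` norms to `𝔼 ‖M‖⁻¹`.
  refine ⟨-Real.log ρ / 2, Real.log b / 2, by linarith [Real.log_neg hρ0 hρ1], fun n => ?_⟩
  have hpos : 0 < ρ ^ n * b := by positivity
  have h1 := neg_log_le_integral_logNorm hcompact E (2 * n) (Real.sqrt_pos.2 hpos) ?_
  · rw [Real.log_sqrt hpos.le, Real.log_mul (by positivity) hb.ne', Real.log_pow] at h1
    linarith
  · have h2 := (lintegral_inv_opNorm_sq_le E (2 * n)).trans (mul_le_mul_right (hρ n) 2)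
    have h3 : 2 * (ENNReal.ofReal (ρ ^ n) * F) ≤ ENNReal.ofReal √(ρ ^ n * b) ^ 2 := by
      rw [← ENNReal.ofReal_pow (Real.sqrt_nonneg _), Real.sq_sqrt hpos.le,
        ENNReal.ofReal_mul (by positivity), ← mul_assoc, mul_comm 2, mul_assoc]
      refine mul_le_mul_right ?_ _
      rw [ENNReal.ofReal_add (by positivity) zero_le_one, ENNReal.ofReal_mul (by norm_num),
        ENNReal.ofReal_toReal hFtop, ENNReal.ofReal_ofNat]
      exact le_self_add
    by_contra! hlt
    exact (ENNReal.pow_lt_pow_left two_ne_zero hlt).not_ge (h2.trans h3)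

theorem lyapunovExponent_pos [IsProbabilityMeasure ν] (hcompact : IsCompact ν.support)
    (hsupp : ν.support.Nontrivial) (E : ℝ) : 0 < lyapunovExponent ν E := by
  obtain ⟨δ, B, hδ, h⟩ := exists_linear_lower_bound hcompact hsupp E
  obtain ⟨c, hc⟩ := exists_boundedCocycle hcompact E
  refine (half_pos hδ).trans_le (le_ciInf fun n => ?_)
  obtain ⟨n, hn⟩ := n
  have hn' : (0 : ℝ) < n := by exact_mod_cast Nat.lt_of_lt_of_le one_pos hn
  change δ / 2 ≤ 1 / (n : ℝ) * ∫ ω, logNorm E n ω ∂(law ν)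
  rw [one_div_mul_eq_div, le_div_iff₀ hn']
  set u := ∫ ω, logNorm E n ω ∂(law ν)
  have hlim : Tendsto (fun m : ℕ => u + B / 2 / m) atTop (𝓝 (u + 0)) :=
    tendsto_const_nhds.add (tendsto_const_div_atTop_nhds_zero_nat _)
  rw [add_zero] at hlim
  refine ge_of_tendsto hlim ((eventually_gt_atTop 0).mono fun m hm => ?_)
  have hm' : (0 : ℝ) < m := by exact_mod_cast hm
  -- Subadditivity over `2 * m` blocks of length `n` covers odd `n` too, and dilutes the constant
  -- `B` as `m → ∞`.
  have h1 := (h (m * n)).trans ((le_of_eq (by rw [mul_assoc])).trans (hc.integral_mul_le (2 * m) n))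
  push_cast at h1
  have h2 : B / 2 / m * m = B / 2 := div_mul_cancel₀ _ hm'.ne'
  refine le_of_mul_le_mul_right ?_ hm'
  rw [add_mul, h2]
  linarith

end Anderson

theorem mainTheorem4 (ν : Measure ℝ) [IsProbabilityMeasure ν]
    (hcompact : IsCompact ν.support) (hsupp : ν.support.Nontrivial) :
    ∀ E : ℝ,
      (∀ᵐ ω ∂(Anderson.law ν),
        Anderson.HasLyapunovBehavior E ω (Anderson.lyapunovExponent ν E)) ∧
      0 < Anderson.lyapunovExponent ν E :=
  fun E => ⟨Anderson.ae_hasLyapunovBehavior hcompact E,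
    Anderson.lyapunovExponent_pos hcompact hsupp E⟩
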